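/- Let $q$ be an odd prime power, $d\ge 2$, and let $\sigma$ be a nondegenerate quadratic form on $V=\mathbb F_q^n$ with $n=2d+1$ or $n=2d$, so that its polar space is of type $O(2d+1,q)$, $O^+(2d,q)$ or $O^-(2d,q)$ (the signs $+$ and $-$ mean Witt index $d$ and $d-1$); let $\perp$ be the associated polarity. Let $V_+$ (resp. $V_-$) be the set of points ($1$-spaces) $\langle x\rangle$ for which $\sigma(x)$ is a nonzero square (resp. a non-square), let $\epsilon\in\{+,-\}$, and let $\Gamma_\epsilon$ be the graph with vertex set $V_\epsilon$ in which two distinct points are adjacent if and only if they are orthogonal. For $m\ge 3$, call $(L_1,L_2)$ a switching pair of rank $m$ if $L_1,L_2$ are subspaces of $V$ of dimension $m-1$ such that $p:=L_1\cap L_2$ has dimension $m-2$, $L_1\cap L_1^\perp=L_2\cap L_2^\perp=p$, and all points of $C_1:=L_1\setminus L_2$ and of $C_2:=L_2\setminus L_1$ lie in $V_\epsilon$. Put $P=\langle L_1,L_2\rangle$. A pair $\{C_1,C_2\}$ of disjoint vertex sets of a finite graph $\Gamma$ is a switching set if $|C_1|=|C_2|$, the subgraphs induced on $C_1$ and $C_2$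 are regular of the same degree, the subgraph induced on $C_1\cup C_2$ is regular, and every vertex $x\notin C_1\cup C_2$ satisfies $|\Gamma(x)\cap C_1|=|\Gamma(x)\cap C_2|$ or $\Gamma(x)\cap(C_1\cup C_2)\in\{C_1,C_2\}$. The graph $\overline\Gamma$ obtained by switching differs from $\Gamma$ only in that every vertex $x\notin C_1\cup C_2$ with $\Gamma(x)\cap(C_1\cup C_2)=C_1$ gets $\overline\Gamma(x)\cap(C_1\cup C_2)=C_2$, and vice versa. 1. If $3\le m\le d$ and $(L_1,L_2)$ is a switching pair of rank $m$, then $\{C_1,C_2\}$ is a switching set of $\Gamma_\epsilon$. Let $\overline\Gamma_\epsilon$ denote the graph obtained by switching. 2. Let $\delta=-$ if $q\equiv 3\pmod 4$ and $\delta=+$ if $q\equiv 1\pmod 4$. If $n\ge 7$, $m=3$ and $P/p$ with the induced form is isomorphic to $O^\delta(2,q)$, then $\overline\Gamma_\epsilon$ is not isomorphic to $\Gamma_\epsilon$. For every $n\ge 7$ such a switching pair exists. 3. In the following cases $\Gamma_\epsilon$ is strongly regular, and for every switching pair of rank $m$ with $3\le m\le d$ the graph $\overline\Gamma_\epsilon$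 is strongly regular with the same parameters $(v,k,\lambda,\mu)$. So for $n\ge7$, part 2 gives strongly regular graphs with the parameters of $\Gamma_\epsilon$ which are not isomorphic to $\Gamma_\epsilon$. Below, for $n=2d+1$, $e=\pm1$ is the sign such that $x^\perp\cong O^{e}(2d,q)$ for all $x\in V_\epsilon$; for $n=2d$, $\zeta=\pm1$ is the sign of the type $O^\zeta(2d,q)$ of $\sigma$. - $O(2d+1,3)$: $v=\tfrac12 3^d(3^d+e)$, $k=\tfrac12 3^{d-1}(3^d-e)$, $\lambda=\mu=\tfrac12 3^{d-1}(3^{d-1}-e)$. - $O^\zeta(2d,3)$: $v=\tfrac12 3^{d-1}(3^d-\zeta)$, $k=\tfrac12 3^{d-1}(3^{d-1}-\zeta)$, $\lambda=\tfrac12 3^{d-2}(3^{d-1}+\zeta)$, $\mu=\tfrac12 3^{d-1}(3^{d-2}-\zeta)$. - $O(2d+1,5)$: $v=\tfrac12 5^d(5^d+e)$, $k=\tfrac12 5^{d-1}(5^d-e)$, $\lambda=\tfrac12 5^{d-1}(5^{d-1}+e)$, $\mu=\tfrac12 5^{d-1}(5^{d-1}-e)$. -/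

import Mathlib

open Module
open scoped LinearAlgebra.Projectivization

/-! ### Switching of graphs -/

/-- The neighbours of `x` lying in `S`. -/
def nbrIn {X : Type*} (G : SimpleGraph X) (x : X) (S : Set X) : Set X := G.neighborSet x ∩ S

/-- `{C₁, C₂}` is a switching set of the finite graph `G`: the vertex set is partitioned as
`C₁ ∪ C₂ ∪ D`, and the hypotheses of Wang-Qiu-Hu switching hold. -/
structure IsSwitchingSet {X : Type*} [Finite X] (G : SimpleGraph X) (C₁ C₂ : Set X) : Prop where
  disjoint : Disjoint C₁ C₂
  card_eq : C₁.ncard = C₂.ncard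
  /-- The subgraphs induced on `C₁` and `C₂` are regular, of the same degree. -/
  regular_parts : ∃ a : ℕ, (∀ x ∈ C₁, (nbrIn G x C₁).ncard = a) ∧
    (∀ x ∈ C₂, (nbrIn G x C₂).ncard = a)
  /-- The subgraph induced on `C₁ ∪ C₂` is regular. -/
  regular_union : ∃ b : ℕ, ∀ x ∈ C₁ ∪ C₂, (nbrIn G x (C₁ ∪ C₂)).ncard = b
  outside : ∀ x ∉ C₁ ∪ C₂, (nbrIn G x C₁).ncard = (nbrIn G x C₂).ncard ∨
    nbrIn G x (C₁ ∪ C₂) = C₁ ∨ nbrIn G x (C₁ ∪ C₂) = C₂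

open Classical in
/-- The neighbours in `C₁ ∪ C₂` that an outside vertex `x` has after switching. -/
noncomputable def switchedNbr {X : Type*} (G : SimpleGraph X) (C₁ C₂ : Set X) (x : X) : Set X :=
  if nbrIn G x (C₁ ∪ C₂) = C₂ then C₁
  else if nbrIn G x (C₁ ∪ C₂) = C₁ then C₂
  else nbrIn G x (C₁ ∪ C₂)

/-- The graph obtained by switching: only edges between `C₁ ∪ C₂` and its complement change. -/
noncomputable def switchedGraph {X : Type*} (G : SimpleGraph X) (C₁ C₂ : Set X) :
    SimpleGraph X where
  Adj x y :=
    ((x ∈ C₁ ∪ C₂ ↔ y ∈ C₁ ∪ C₂) ∧ G.Adj x y) ∨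
    (x ∉ C₁ ∪ C₂ ∧ y ∈ C₁ ∪ C₂ ∧ y ∈ switchedNbr G C₁ C₂ x) ∨
    (y ∉ C₁ ∪ C₂ ∧ x ∈ C₁ ∪ C₂ ∧ x ∈ switchedNbr G C₁ C₂ y)
  symm := ⟨fun x y h => by
    rcases h with ⟨h, h'⟩ | h | h
    · exact Or.inl ⟨h.symm, h'.symm⟩
    · exact Or.inr (Or.inr h)
    · exact Or.inr (Or.inl h)⟩
  loopless := ⟨fun x h => by
    rcases h with ⟨_, h⟩ | ⟨h, h', _⟩ | ⟨h, h', _⟩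
    · exact G.loopless.irrefl x h
    · exact h h'
    · exact h h'⟩

open Classical in
/-- Strong regularity with parameters `(v, k, l, mu)` for a graph on a finite type. -/
def StronglyRegular {X : Type*} [Finite X] (G : SimpleGraph X) (v k l mu : ℕ) : Prop :=
  letI : Fintype X := Fintype.ofFinite X
  G.IsSRGWith v k l mu

/-! ### Quadratic forms -/

section Forms

variable {F : Type*} [Field F] {V : Type*} [AddCommGroup V] [Module F V]

/-- Nondegeneracy of a quadratic form, through its polar bilinear form. -/
def FormNondegenerate (Q : QuadraticForm F V) : Prop :=
  LinearMap.BilinForm.Nondegenerate Q.polarBilin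

/-- The subspace `L^⊥`. -/
def perp (Q : QuadraticForm F V) (L : Submodule F V) : Submodule F V :=
  LinearMap.BilinForm.orthogonal Q.polarBilin L

/-- `r` is the maximal dimension of a totally singular subspace (the rank of the polar space). -/
def HasWittIndex (Q : QuadraticForm F V) (r : ℕ) : Prop :=
  IsGreatest {k : ℕ | ∃ U : Submodule F V, (∀ u ∈ U, Q u = 0) ∧ finrank F U = k} r

/-- `Q` is of type `O^s(2k, q)`, with `s = 1` for `+` (Witt index `k`) and `s = -1` for `-`
(Witt index `k - 1`). -/
def IsEvenType (Q : QuadraticForm F V) (k : ℕ) (s : ℤˣ) : Prop :=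
  FormNondegenerate Q ∧ finrank F V = 2 * k ∧
    ((s = 1 ∧ HasWittIndex Q k) ∨ (s = -1 ∧ ∃ r, r + 1 = k ∧ HasWittIndex Q r))

/-- The form induced by `Q` on `P / p` is of type `O^s(2, q)`; such an induced form is unique. -/
def QuotientHasType (Q : QuadraticForm F V) (P p : Submodule F V) (s : ℤˣ) : Prop :=
  ∃ Q' : QuadraticForm F (P ⧸ p.submoduleOf P),
    (∀ v : P, Q' (Submodule.Quotient.mk v) = Q (v : V)) ∧ IsEvenType Q' 1 s

/-! ### The graph on one class of non-isotropic points -/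

variable [Fintype F] [DecidableEq F]

/-- The set `V_ε` of points on which `Q` takes nonzero square values (`ε = 1`), respectively
non-square values (`ε = -1`). The class does not depend on the vector representing a point. -/
abbrev ClassPoint (Q : QuadraticForm F V) (ε : ℤˣ) : Type _ :=
  {x : ℙ F V // quadraticChar F (Q x.rep) = (ε : ℤ)}

/-- The graph `Γ_ε`: the points of `V_ε`, adjacent when orthogonal. -/
def orthGraph (Q : QuadraticForm F V) (ε : ℤˣ) : SimpleGraph (ClassPoint Q ε) where
  Adj x y := x ≠ y ∧ QuadraticMap.polar Q x.1.rep y.1.rep = 0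
  symm := ⟨fun x y h => ⟨h.1.symm, by rw [QuadraticMap.polar_comm]; exact h.2⟩⟩
  loopless := ⟨fun _ h => h.1 rfl⟩

/-- The vertices of `Γ_ε` in `L` but not in `L'`. -/
def pointDiff (Q : QuadraticForm F V) (ε : ℤˣ) (L L' : Submodule F V) :
    Set (ClassPoint Q ε) :=
  {x | x.1.submodule ≤ L ∧ ¬ x.1.submodule ≤ L'}

/-- `L₁` and `L₂` are subspaces of dimension `m - 1` whose intersection has dimension `m - 2` and is
the radical of both, and all points of `L₁ ∖ L₂` and `L₂ ∖ L₁` are in `V_ε`. -/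
structure IsSwitchingPair (Q : QuadraticForm F V) (ε : ℤˣ) (m : ℕ) (L₁ L₂ : Submodule F V) :
    Prop where
  finrank_left : finrank F L₁ + 1 = m
  finrank_right : finrank F L₂ + 1 = m
  finrank_inf : finrank F ↥(L₁ ⊓ L₂) + 2 = m
  radical_left : L₁ ⊓ perp Q L₁ = L₁ ⊓ L₂
  radical_right : L₂ ⊓ perp Q L₂ = L₁ ⊓ L₂
  type_left : ∀ x : ℙ F V, x.submodule ≤ L₁ → ¬ x.submodule ≤ L₂ →
    quadraticChar F (Q x.rep) = (ε : ℤ)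
  type_right : ∀ x : ℙ F V, x.submodule ≤ L₂ → ¬ x.submodule ≤ L₁ →
    quadraticChar F (Q x.rep) = (ε : ℤ)

/-- The graph obtained from `Γ_ε` by switching with respect to `L₁ ∖ L₂` and `L₂ ∖ L₁`. -/
noncomputable def switchedOrthGraph (Q : QuadraticForm F V) (ε : ℤˣ) (L₁ L₂ : Submodule F V) :
    SimpleGraph (ClassPoint Q ε) :=
  switchedGraph (orthGraph Q ε) (pointDiff Q ε L₁ L₂) (pointDiff Q ε L₂ L₁)

end Forms

/-- The sign `δ`: `+` if `q ≡ 1 (mod 4)`, and `-` otherwise. -/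
def deltaSign (q : ℕ) : ℤˣ := if q % 4 = 1 then 1 else -1

/-!
`q = |F|`, `B` is the polar form of `Q`, and `χ` the quadratic character of `F`.

**Switching sets.** Put `p = L₁ ∩ L₂`. Since `p` is the radical of `L₁` and of `L₂`, the form vanishes
on `p`, and `Cᵢ = {⟨xᵢ + u⟩ : u ∈ p}` for any `xᵢ ∈ Lᵢ ∖ p`. Adjacency of a vertex `y` to `⟨xᵢ + u⟩`
is the equation `B(y, u) = -B(y, xᵢ)`. If `y ⊥ p` it does not depend on `u`; otherwise exactly
`|p| / q` elements `u ∈ p` satisfy it, for `i = 1` and for `i = 2`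
(`IsSwitchingPair.isSwitchingSet`).

**Nonisomorphism.** In `Γ_ε`, two nonadjacent vertices `x, y` always admit a third vertex adjacent to
all their common neighbours: the reflection of `y` in `x^⊥` (`exists_third_vertex`). In the switched
graph for `m = 3`, with `p = ⟨r⟩`, this fails for a vertex `x₁` of `C₁` and a vertex `w` with
`B(w, r) ≠ 0` and `B(w, x₁) ≠ 0`. Their common neighbours not orthogonal to `r` are not affected by
switching and force a third vertex onto the line `⟨x₁, w⟩`; those orthogonal to `r` must now be
orthogonal to `x₂` instead of `x₁`, and force it onto `w`. The required neighbours exist because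
`K = ⟨r, x₁, x₂, w⟩` is nondegenerate and `dim K^⊥ ≥ 3`, so that values of `Q` can be adjusted in
`K^⊥` (`exists_same_polar_on`, `IsSwitchingPair.exists_pair_without_third`).

**Strong regularity.** Splitting off nonsingular vectors one at a time gives the number of solutions
of `Q v = c` in a nondegenerate space, up to a sign (`exists_count_of_nondegOn`), and shows how the
sign changes on passing to `x^⊥` (`HasEvenCount.inf_perp`, `HasOddCount.inf_perp`). In even dimension
the sign is the type of the form, because a maximal totally singular subspace `U` contains all
singular vectors of `U^⊥` (`HasEvenCount.isEvenType`). A point of class `χ c` carries two vectors of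
value `c`, so `v`, `k`, `λ` are half the number of solutions of `Q v = c` in `V`, `x^⊥` and
`⟨x, y⟩^⊥`. The same holds for `μ`; for `q = 3` the span of two nonorthogonal vertices is
degenerate, and for `q = 5` it is degenerate or has nonsquare determinant, with the same
count in both cases.
Switching conjugates the adjacency matrix by the reflection in `1_{C₁} - 1_{C₂}`, which fixes the
all-one vector, so the matrix equation of strong regularity persists
(`StronglyRegular.switchedGraph`).
-/

open QuadraticMap

/-! ### Vectors and subspaces of a quadratic space, and their value counts -/

section Basic

variable {F : Type*} [Field F] {V : Type*} [AddCommGroup V] [Module F V]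

lemma polar_smul_self_add (Q : QuadraticForm F V) (a : F) (x v : V) :
    Q (a • x + v) = a ^ 2 * Q x + a * polar Q x v + Q v := by
  have h := QuadraticMap.map_add Q (a • x) v
  rw [h, QuadraticMap.map_smul, polar_smul_left]
  simp only [smul_eq_mul]
  ring

lemma polar_self_eq (Q : QuadraticForm F V) (x : V) : polar Q x x = 2 * Q x := by
  rw [polar_self]; simp

lemma mem_perp_iff {Q : QuadraticForm F V} {L : Submodule F V} {v : V} :
    v ∈ perp Q L ↔ ∀ u ∈ L, polar Q u v = 0 := by
  simp [perp, LinearMap.BilinForm.mem_orthogonal_iff]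

lemma mem_perp_span_singleton {Q : QuadraticForm F V} {x v : V} :
    v ∈ perp Q (F ∙ x) ↔ polar Q x v = 0 := by
  rw [mem_perp_iff]
  refine ⟨fun h => h x (Submodule.mem_span_singleton_self x), fun h u hu => ?_⟩
  obtain ⟨a, rfl⟩ := Submodule.mem_span_singleton.1 hu
  rw [polar_smul_left, h, smul_zero]

lemma isRefl_polarBilin (Q : QuadraticForm F V) : LinearMap.BilinForm.IsRefl Q.polarBilin := by
  intro x y h
  rw [polarBilin_apply_apply] at h ⊢
  rw [polar_comm, h]

/-- The restriction of `Q` to the subspace `W` is nondegenerate. -/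
def NondegOn (Q : QuadraticForm F V) (W : Submodule F V) : Prop :=
  ∀ v ∈ W, (∀ w ∈ W, polar Q v w = 0) → v = 0

lemma formNondegenerate_iff {Q : QuadraticForm F V} :
    FormNondegenerate Q ↔ ∀ v, (∀ w, polar Q v w = 0) → v = 0 := by
  unfold FormNondegenerate LinearMap.BilinForm.Nondegenerate
  rw [(isRefl_polarBilin Q).nondegenerate_iff_separatingLeft]
  rfl

lemma nondegOn_top_iff {Q : QuadraticForm F V} : NondegOn Q ⊤ ↔ FormNondegenerate Q := by
  simp [formNondegenerate_iff, NondegOn]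

lemma polar_restrict (Q : QuadraticForm F V) (W : Submodule F V) (v w : W) :
    polar (Q.restrict W) v w = polar Q (v : V) w := by
  simp [polar]

lemma formNondegenerate_restrict_iff {Q : QuadraticForm F V} {W : Submodule F V} :
    FormNondegenerate (Q.restrict W) ↔ NondegOn Q W := by
  rw [formNondegenerate_iff]
  constructor
  · intro h v hv hw
    have := h ⟨v, hv⟩ (fun w => by rw [polar_restrict]; exact hw w w.2)
    simpa using this
  · intro h v hv
    have := h v v.2 (fun w hw => by simpa [polar_restrict] using hv ⟨w, hw⟩)
    simpa using this

lemma finrank_inf_perp_span [FiniteDimensional F V] {Q : QuadraticForm F V} {W : Submodule F V}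
    {x w : V} (hw : w ∈ W) (hxw : polar Q x w ≠ 0) :
    finrank F ↥(W ⊓ perp Q (F ∙ x)) + 1 = finrank F W := by
  set f : W →ₗ[F] F := (Q.polarBilin x).domRestrict W with hf
  have hfa : ∀ v : W, f v = polar Q x v := fun v => rfl
  have hsurj : Function.Surjective f :=
    LinearMap.surjective fun h0 => hxw <| by rw [← hfa ⟨w, hw⟩, h0]; rfl
  have h1 := LinearMap.finrank_range_add_finrank_ker f
  rw [LinearMap.range_eq_top.2 hsurj, finrank_top, finrank_self] at h1
  have h2 : (LinearMap.ker f).map W.subtype = W ⊓ perp Q (F ∙ x) := by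
    ext v
    simp only [Submodule.mem_map, LinearMap.mem_ker, Submodule.mem_inf, mem_perp_span_singleton]
    constructor
    · rintro ⟨y, hy, rfl⟩
      exact ⟨y.2, hy⟩
    · rintro ⟨hv, hv'⟩
      exact ⟨⟨v, hv⟩, hv', rfl⟩
  have h3 : finrank F ↥((LinearMap.ker f).map W.subtype) = finrank F (LinearMap.ker f) :=
    Submodule.finrank_map_subtype_eq W _
  rw [← h2, h3]
  omega

lemma exists_map_ne_zero {Q : QuadraticForm F V} {W : Submodule F V} (hW : NondegOn Q W)
    (h : W ≠ ⊥) : ∃ x ∈ W, Q x ≠ 0 := by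
  by_contra! hc
  refine h ((Submodule.eq_bot_iff _).2 fun v hv => hW v hv fun w hw => ?_)
  simp [polar, hc _ hv, hc _ hw, hc _ (W.add_mem hv hw)]

variable (h2 : (2 : F) ≠ 0)
include h2

/-- The component of `v` orthogonal to the non-singular vector `x`. -/
lemma sub_proj_mem_perp {Q : QuadraticForm F V} {x : V} (hx : Q x ≠ 0) (v : V) :
    polar Q x (v - (polar Q x v / (2 * Q x)) • x) = 0 := by
  rw [polar_sub_right, polar_smul_right, polar_self_eq, smul_eq_mul]
  field_simp
  simp

lemma NondegOn.inf_perp {Q : QuadraticForm F V} {W : Submodule F V} (hW : NondegOn Q W) {x : V}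
    (hxW : x ∈ W) (hx : Q x ≠ 0) : NondegOn Q (W ⊓ perp Q (F ∙ x)) := by
  rintro v ⟨hv, hvx⟩ h
  rw [SetLike.mem_coe, mem_perp_span_singleton] at hvx
  refine hW v hv fun w hw => ?_
  have h1 := h (w - (polar Q x w / (2 * Q x)) • x)
    ⟨W.sub_mem hw (W.smul_mem _ hxW), mem_perp_span_singleton.2 (sub_proj_mem_perp h2 hx w)⟩
  rwa [polar_sub_right, polar_smul_right, polar_comm _ v x, hvx, smul_zero, sub_zero] at h1

lemma finrank_inf_perp_of_map_ne_zero [FiniteDimensional F V] {Q : QuadraticForm F V}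
    {W : Submodule F V} {x : V} (hxW : x ∈ W) (hx : Q x ≠ 0) :
    finrank F ↥(W ⊓ perp Q (F ∙ x)) + 1 = finrank F W :=
  finrank_inf_perp_span hxW (by rw [polar_self_eq]; exact mul_ne_zero h2 hx)

end Basic

section Levels

variable {F : Type*} [Field F] {V : Type*} [AddCommGroup V] [Module F V]

/-- The number of vectors of `W` on which `Q` takes the value `c`. -/
noncomputable def levelCount (Q : QuadraticForm F V) (W : Submodule F V) (c : F) : ℕ :=
  Nat.card {v : V // v ∈ W ∧ Q v = c}

lemma levelCount_restrict (Q : QuadraticForm F V) (W : Submodule F V) (c : F) :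
    levelCount (Q.restrict W) ⊤ c = levelCount Q W c :=
  Nat.card_congr
    { toFun := fun v => ⟨v.1, v.1.2, v.2.2⟩
      invFun := fun v => ⟨⟨v.1, v.2.1⟩, trivial, v.2.2⟩
      left_inv := fun _ => rfl
      right_inv := fun _ => rfl }

lemma levelCount_bot [DecidableEq F] (Q : QuadraticForm F V) (c : F) :
    levelCount Q ⊥ c = if c = 0 then 1 else 0 := by
  unfold levelCount
  split_ifs with h
  · subst h
    rw [Nat.card_eq_one_iff_unique]
    refine ⟨⟨fun a b => Subtype.ext ?_⟩, ⟨⟨0, by simp⟩⟩⟩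
    rw [(Submodule.mem_bot F).1 a.2.1, (Submodule.mem_bot F).1 b.2.1]
  · rw [Nat.card_eq_zero]
    left
    refine ⟨fun v => h ?_⟩
    have := v.2.2
    rw [(Submodule.mem_bot F).1 v.2.1] at this
    simpa using this.symm

lemma exists_of_levelCount_pos {Q : QuadraticForm F V} {W : Submodule F V} {c : F}
    (h : 0 < levelCount Q W c) : ∃ v ∈ W, Q v = c := by
  obtain ⟨v⟩ := (Nat.card_pos_iff.1 h).1
  exact ⟨v.1, v.2⟩

variable [Fintype F] [Finite V]

lemma levelCount_eq_sum (h2 : (2 : F) ≠ 0) (Q : QuadraticForm F V) {W : Submodule F V} {x : V}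
    (hxW : x ∈ W) (hx : Q x ≠ 0) (c : F) :
    levelCount Q W c = ∑ t : F, levelCount Q (W ⊓ perp Q (F ∙ x)) (c - t ^ 2 * Q x) := by
  unfold levelCount
  rw [← Nat.card_sigma]
  symm
  refine Nat.card_eq_of_bijective
    (fun v => ⟨v.1 • x + v.2.1, W.add_mem (W.smul_mem _ hxW) v.2.2.1.1, ?_⟩) ⟨?_, ?_⟩
  · have h1 := mem_perp_span_singleton.1 v.2.2.1.2
    rw [polar_smul_self_add, h1, v.2.2.2]
    ring
  · rintro ⟨t, v, hv, hvc⟩ ⟨t', v', hv', hvc'⟩ h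
    have h' : t • x + v = t' • x + v' := congrArg Subtype.val h
    have e : polar Q x (t • x + v) = polar Q x (t' • x + v') := by rw [h']
    rw [polar_add_right, polar_add_right, polar_smul_right, polar_smul_right,
      mem_perp_span_singleton.1 hv.2, mem_perp_span_singleton.1 hv'.2, polar_self_eq] at e
    have ht : t = t' := by
      simpa [h2, hx] using e
    subst ht
    have : v = v' := by simpa using h'
    subst this
    rfl
  · rintro ⟨v, hv, hvc⟩
    have hm := sub_proj_mem_perp h2 hx v
    refine ⟨⟨polar Q x v / (2 * Q x), v - (polar Q x v / (2 * Q x)) • x,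
      ⟨W.sub_mem hv (W.smul_mem _ hxW), mem_perp_span_singleton.2 hm⟩, ?_⟩, ?_⟩
    · have := polar_smul_self_add Q (polar Q x v / (2 * Q x)) x
        (v - (polar Q x v / (2 * Q x)) • x)
      rw [hm, add_sub_cancel, hvc] at this
      rw [this]
      ring
    · simp

omit [Fintype F] [Finite V] in
/-- All fibres of a nonzero linear functional have the same size. -/
lemma card_fiber_functional (f : V →ₗ[F] F) (hf : f ≠ 0) (a b : F) :
    Nat.card {v // f v = a} = Nat.card {v // f v = b} := by
  obtain ⟨w, hw⟩ := LinearMap.surjective hf (b - a)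
  exact Nat.card_congr
    { toFun := fun v => ⟨v.1 + w, by rw [map_add, v.2, hw]; ring⟩
      invFun := fun v => ⟨v.1 - w, by rw [map_sub, v.2, hw]; ring⟩
      left_inv := fun v => by simp
      right_inv := fun v => by simp }

lemma card_mul_card_fiber_functional (f : V →ₗ[F] F) (hf : f ≠ 0) (a : F) :
    Fintype.card F * Nat.card {v // f v = a} = Nat.card V := by
  rw [Nat.card_congr (Equiv.sigmaFiberEquiv f).symm, Nat.card_sigma,
    Finset.sum_congr rfl fun b _ => card_fiber_functional f hf b a]
  simp

/-- Translating by a totally singular subspace `U ≤ W` equidistributes the values of `Q` on the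
vectors of `W` that are not orthogonal to `U`. -/
lemma card_mul_levelCount_of_singular (Q : QuadraticForm F V) {W U : Submodule F V} (hUW : U ≤ W)
    (hU : ∀ u ∈ U, Q u = 0) (c : F) :
    Fintype.card F * levelCount Q W c + Nat.card ↥(W ⊓ perp Q U) =
      Fintype.card F * levelCount Q (W ⊓ perp Q U) c + Nat.card W := by
  classical
  have hUp : ∀ u ∈ U, ∀ v ∈ U, polar Q u v = 0 := fun u hu v hv => by
    simp [polar, hU _ hu, hU _ hv, hU _ (U.add_mem hu hv)]
  have key : ∀ v ∈ W, ∀ u ∈ U, (v + u ∈ perp Q U ↔ v ∈ perp Q U) := by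
    intro v _ u hu
    simp only [mem_perp_iff]
    refine forall₂_congr fun y hy => ?_
    rw [polar_add_right, hUp y hy u hu, add_zero]
  -- `M` counts the vectors of `W` outside `U^⊥` with value `c`
  set M := Nat.card {v : V // v ∈ W ∧ v ∉ perp Q U ∧ Q v = c} with hM
  have e1 : levelCount Q W c = levelCount Q (W ⊓ perp Q U) c + M := by
    unfold levelCount
    rw [hM, ← Nat.card_sum]
    refine (Nat.card_eq_of_bijective (Sum.elim (fun v => ⟨v.1, v.2.1.1, v.2.2⟩)
      (fun v => ⟨v.1, v.2.1, v.2.2.2⟩)) ⟨?_, ?_⟩).symm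
    · rintro (v | v) (w | w) h <;> have h' := congrArg Subtype.val h <;>
        simp only [Sum.elim_inl, Sum.elim_inr] at h'
      · rw [Subtype.ext h']
      · exact absurd v.2.1.2 (by rw [h']; exact w.2.2.1)
      · exact absurd w.2.1.2 (by rw [← h']; exact v.2.2.1)
      · rw [Subtype.ext h']
    · rintro ⟨v, hv, hvc⟩
      by_cases h : v ∈ perp Q U
      · exact ⟨Sum.inl ⟨v, ⟨hv, h⟩, hvc⟩, rfl⟩
      · exact ⟨Sum.inr ⟨v, hv, h, hvc⟩, rfl⟩
  have e2 : Nat.card W = Nat.card ↥(W ⊓ perp Q U) +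
      Nat.card {v : V // v ∈ W ∧ v ∉ perp Q U} := by
    rw [← Nat.card_sum]
    refine (Nat.card_eq_of_bijective (Sum.elim (fun v => ⟨v.1, v.2.1⟩)
      (fun v => ⟨v.1, v.2.1⟩)) ⟨?_, ?_⟩).symm
    · rintro (v | v) (w | w) h <;> have h' := congrArg Subtype.val h <;>
        simp only [Sum.elim_inl, Sum.elim_inr] at h'
      · rw [Subtype.ext h']
      · exact absurd v.2.2 (by rw [h']; exact w.2.2)
      · exact absurd w.2.2 (by rw [← h']; exact v.2.2)
      · rw [Subtype.ext h']
    · rintro ⟨v, hv⟩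
      by_cases h : v ∈ perp Q U
      · exact ⟨Sum.inl ⟨v, ⟨hv, h⟩⟩, rfl⟩
      · exact ⟨Sum.inr ⟨v, hv, h⟩, rfl⟩
  -- count the pairs `(v, u)` with `v ∉ U^⊥`, `u ∈ U` and `Q (v + u) = c` in two ways
  have e3 : Nat.card (Σ v : {v : V // v ∈ W ∧ v ∉ perp Q U}, {u : U // Q (v.1 + u) = c}) =
      M * Nat.card U := by
    rw [hM, ← Nat.card_prod]
    refine Nat.card_congr
      { toFun := fun p => (⟨p.1.1 + p.2.1, W.add_mem p.1.2.1 (hUW p.2.1.2),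
          fun h => p.1.2.2 ((key _ p.1.2.1 _ p.2.1.2).1 h), p.2.2⟩, p.2.1)
        invFun := fun p => ⟨⟨p.1.1 + ((-p.2 : U) : V), W.add_mem p.1.2.1 (hUW (-p.2).2),
          fun h => p.1.2.2.1 ((key _ p.1.2.1 _ (-p.2).2).1 h)⟩, ⟨p.2, by simp [p.1.2.2.2]⟩⟩
        left_inv := fun p => ?_
        right_inv := fun p => ?_ }
    · exact Sigma.subtype_ext (Subtype.ext (by simp)) rfl
    · exact Prod.ext (Subtype.ext (by simp)) rfl
  have e4 : Fintype.card F *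
      Nat.card (Σ v : {v : V // v ∈ W ∧ v ∉ perp Q U}, {u : U // Q (v.1 + u) = c}) =
      Nat.card {v : V // v ∈ W ∧ v ∉ perp Q U} * Nat.card U := by
    have := Fintype.ofFinite {v : V // v ∈ W ∧ v ∉ perp Q U}
    rw [Nat.card_sigma, Finset.mul_sum, Finset.sum_congr rfl (g := fun _ => Nat.card U)]
    · simp
    intro v _
    have hne : (Q.polarBilin v.1).domRestrict U ≠ 0 := by
      intro h0
      refine v.2.2 (mem_perp_iff.2 fun u hu => ?_)
      rw [polar_comm]
      exact congrArg (fun f : U →ₗ[F] F => f ⟨u, hu⟩) h0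
    rw [← card_mul_card_fiber_functional _ hne (c - Q v.1)]
    congr 1
    refine Nat.card_congr (Equiv.subtypeEquivRight fun u => ?_)
    rw [QuadraticMap.map_add Q, hU u u.2, eq_sub_iff_add_eq, add_zero, add_comm]
    rfl
  have hpos : 0 < Nat.card U := Nat.card_pos
  have e5 : Fintype.card F * M = Nat.card {v : V // v ∈ W ∧ v ∉ perp Q U} := by
    rw [e3] at e4
    exact Nat.eq_of_mul_eq_mul_right hpos (by rw [← e4]; ring)
  rw [e1, e2, mul_add, e5]
  ring

end Levels

/-! ### Value counts of nondegenerate forms and the Witt index -/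

section CharacterSums

variable {F : Type*} [Field F] [Fintype F] [DecidableEq F]

lemma exists_sign_quadraticChar {a : F} (ha : a ≠ 0) :
    ∃ η : ℤˣ, quadraticChar F a = (η : ℤ) := by
  rcases quadraticChar_dichotomy ha with h | h
  · exact ⟨1, by simp [h]⟩
  · exact ⟨-1, by simp [h]⟩

lemma ne_zero_of_quadraticChar_eq {a : F} {η : ℤˣ} (h : quadraticChar F a = (η : ℤ)) : a ≠ 0 :=
  fun h0 => by simp [h0] at h; exact η.ne_zero h.symm

omit [Fintype F] [DecidableEq F] in
lemma ringChar_ne_two_of_two_ne_zero (h2 : (2 : F) ≠ 0) : ringChar F ≠ 2 := by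
  intro h
  apply h2
  have := CharP.cast_eq_zero F (ringChar F)
  rw [h] at this
  exact_mod_cast this

lemma exists_quadraticChar_eq (h2 : (2 : F) ≠ 0) (η : ℤˣ) :
    ∃ a : F, quadraticChar F a = (η : ℤ) := by
  rcases Int.units_eq_one_or η with rfl | rfl
  · exact ⟨1, by simp⟩
  · exact quadraticChar_exists_neg_one (ringChar_ne_two_of_two_ne_zero h2)

/-- Fibring over the squares: every `s` is the square of `1 + χ s` elements. -/
lemma sum_comp_sq (h2 : (2 : F) ≠ 0) (f : F → ℤ) :
    ∑ t : F, f (t ^ 2) = ∑ s : F, (1 + quadraticChar F s) * f s := by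
  rw [← Finset.sum_fiberwise_of_maps_to (g := fun t : F => t ^ 2) (t := Finset.univ)
    (fun _ _ => Finset.mem_univ _)]
  refine Finset.sum_congr rfl fun s _ => ?_
  have h1 := quadraticChar_card_sqrts (ringChar_ne_two_of_two_ne_zero h2) s
  rw [Finset.sum_congr rfl (g := fun _ => f s) (fun t ht => by rw [(Finset.mem_filter.1 ht).2]),
    Finset.sum_const, nsmul_eq_mul, add_comm 1, ← h1]
  congr 3
  ext t
  simp

lemma sum_quadraticChar_sub_sq_mul (h2 : (2 : F) ≠ 0) {a : F} (ha : a ≠ 0) (c : F) :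
    ∑ t : F, quadraticChar F (c - t ^ 2 * a) =
      quadraticChar F (-a) * (if c = 0 then (Fintype.card F : ℤ) - 1 else -1) := by
  have hsum0 := quadraticChar_sum_zero (ringChar_ne_two_of_two_ne_zero h2)
  rw [sum_comp_sq h2 (fun s => quadraticChar F (c - s * a))]
  simp only [add_mul, one_mul, Finset.sum_add_distrib]
  have e1 : ∑ s : F, quadraticChar F (c - s * a) = 0 := by
    rw [← hsum0]
    refine Fintype.sum_bijective (fun s => c - s * a) ⟨fun s t h => ?_, fun y => ?_⟩ _ _
      fun _ => rfl
    · simpa [ha] using h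
    · exact ⟨(c - y) / a, by field_simp; ring⟩
  rw [e1, zero_add]
  have e2 : ∀ s : F, quadraticChar F s * quadraticChar F (c - s * a) =
      if s = 0 then 0 else quadraticChar F (c * s⁻¹ - a) := by
    intro s
    split_ifs with hs
    · simp [hs]
    · have : c - s * a = s * (c * s⁻¹ - a) := by field_simp
      rw [this, map_mul, ← mul_assoc, ← map_mul, ← _root_.sq, quadraticChar_sq_one' hs, one_mul]
  rw [Finset.sum_congr rfl fun s _ => e2 s]
  split_ifs with hc
  · subst hc
    simp only [zero_mul, zero_sub]
    rw [Finset.sum_ite]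
    simp only [Finset.sum_const_zero, zero_add, Finset.sum_const, nsmul_eq_mul]
    rw [Finset.filter_ne' Finset.univ (0 : F), Finset.card_erase_of_mem (Finset.mem_univ _),
      Finset.card_univ, Nat.cast_sub Fintype.card_pos]
    push_cast
    ring
  · have e3 : ∑ s : F, (if s = 0 then 0 else quadraticChar F (c * s⁻¹ - a)) =
        ∑ s : F, (quadraticChar F (c * s⁻¹ - a) - if s = 0 then quadraticChar F (-a) else 0) := by
      refine Finset.sum_congr rfl fun s _ => ?_
      split_ifs with hs
      · simp [hs]
      · simp
    have e4 : ∑ s : F, quadraticChar F (c * s⁻¹ - a) = 0 := by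
      rw [← hsum0]
      refine Fintype.sum_bijective (fun s => c * s⁻¹ - a) ⟨fun s t h => ?_, fun y => ?_⟩ _ _
        fun _ => rfl
      · simpa [hc] using h
      · exact ⟨((y + a) / c)⁻¹, by field_simp; ring⟩
    rw [e3, Finset.sum_sub_distrib, e4]
    simp

lemma sum_ite_sub_sq_mul (h2 : (2 : F) ≠ 0) {a : F} (ha : a ≠ 0) (c : F) :
    ∑ t : F, (if c - t ^ 2 * a = 0 then (Fintype.card F : ℤ) - 1 else -1) =
      Fintype.card F * (quadraticChar F a * quadraticChar F c) := by
  rw [sum_comp_sq h2 (fun s => if c - s * a = 0 then (Fintype.card F : ℤ) - 1 else -1)]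
  have e : ∀ s : F, (1 + quadraticChar F s) *
      (if c - s * a = 0 then (Fintype.card F : ℤ) - 1 else -1) =
      (if s = c / a then (1 + quadraticChar F s) * Fintype.card F else 0) -
        (1 + quadraticChar F s) := by
    intro s
    have : c - s * a = 0 ↔ s = c / a := by
      rw [sub_eq_zero, eq_div_iff ha, eq_comm]
    simp only [this]
    split_ifs <;> ring
  rw [Finset.sum_congr rfl fun s _ => e s, Finset.sum_sub_distrib, Finset.sum_add_distrib,
    quadraticChar_sum_zero (ringChar_ne_two_of_two_ne_zero h2)]
  simp only [Finset.sum_ite_eq', Finset.mem_univ, if_true, Finset.sum_const, Finset.card_univ,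
    nsmul_eq_mul, mul_one, add_zero]
  have : quadraticChar F (c / a) = quadraticChar F a * quadraticChar F c := by
    rw [← map_mul, show a * c = a ^ 2 * (c / a) by field_simp, map_mul, quadraticChar_sq_one' ha,
      one_mul]
  rw [this]
  ring

end CharacterSums

section Counts

variable {F : Type*} [Field F] [Fintype F] [DecidableEq F]
  {V : Type*} [AddCommGroup V] [Module F V]

/-- `W` has dimension `2k`, and `Q` takes its values on `W` as often as a form of type
`O^s(2k, q)` does. The count is multiplied by `q` so that `k = 0` needs no separate treatment. -/
structure HasEvenCount (Q : QuadraticForm F V) (W : Submodule F V) (k : ℕ) (s : ℤˣ) : Prop where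
  finrank_eq : finrank F W = 2 * k
  count : ∀ c : F, (Fintype.card F : ℤ) * levelCount Q W c = (Fintype.card F : ℤ) ^ (2 * k) +
    s * (if c = 0 then (Fintype.card F : ℤ) - 1 else -1) * (Fintype.card F : ℤ) ^ k

/-- `W` has dimension `2k + 1`, and `Q` takes its values on `W` as often as a nondegenerate form
does for which the hyperplanes `x^⊥` are of type `O^s(2k, q)` when `Q x` is a nonzero square. -/
structure HasOddCount (Q : QuadraticForm F V) (W : Submodule F V) (k : ℕ) (s : ℤˣ) : Prop where
  finrank_eq : finrank F W = 2 * k + 1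
  count : ∀ c : F, (levelCount Q W c : ℤ) = (Fintype.card F : ℤ) ^ (2 * k) +
    s * quadraticChar F c * (Fintype.card F : ℤ) ^ k

lemma HasEvenCount.sign_unique {Q : QuadraticForm F V} {W : Submodule F V} {k : ℕ} {s t : ℤˣ}
    (hs : HasEvenCount Q W k s) (ht : HasEvenCount Q W k t) : s = t := by
  have h1 : (1 : ℤ) < Fintype.card F := by exact_mod_cast Fintype.one_lt_card
  have h := (hs.count 1).symm.trans (ht.count 1)
  simp only [one_ne_zero, if_false] at h
  have hk : (Fintype.card F : ℤ) ^ k ≠ 0 := by positivity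
  have : (s : ℤ) = t := by
    have := add_left_cancel h
    have := mul_right_cancel₀ hk this
    linarith
  exact Units.ext this

lemma HasOddCount.sign_unique {Q : QuadraticForm F V} {W : Submodule F V} {k : ℕ} {s t : ℤˣ}
    (hs : HasOddCount Q W k s) (ht : HasOddCount Q W k t) : s = t := by
  have h1 : (1 : ℤ) < Fintype.card F := by exact_mod_cast Fintype.one_lt_card
  have h := (hs.count 1).symm.trans (ht.count 1)
  have hk : (Fintype.card F : ℤ) ^ k ≠ 0 := by positivity
  have : (s : ℤ) = t := by
    simpa [hk] using h
  exact Units.ext this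

variable [Finite V] (h2 : (2 : F) ≠ 0) {Q : QuadraticForm F V} {W : Submodule F V} {x : V}
  {k : ℕ} {s η δ : ℤˣ}
include h2

lemma hasEvenCount_of_perp (hδ : quadraticChar F (-1) = (δ : ℤ)) (hxW : x ∈ W)
    (hx : quadraticChar F (Q x) = (η : ℤ)) (h : HasOddCount Q (W ⊓ perp Q (F ∙ x)) k s) :
    HasEvenCount Q W (k + 1) (s * η * δ) := by
  have hx0 : Q x ≠ 0 := ne_zero_of_quadraticChar_eq hx
  refine ⟨?_, fun c => ?_⟩
  · rw [← finrank_inf_perp_of_map_ne_zero h2 hxW hx0, h.finrank_eq]; ring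
  · rw [levelCount_eq_sum h2 Q hxW hx0 c]
    push_cast
    simp only [h.count, Finset.sum_add_distrib, ← Finset.sum_mul, ← Finset.mul_sum]
    rw [sum_quadraticChar_sub_sq_mul h2 hx0, neg_eq_neg_one_mul (Q x), map_mul, hδ, hx]
    simp only [Finset.sum_const, Finset.card_univ, nsmul_eq_mul]
    ring

lemma hasOddCount_of_perp (hxW : x ∈ W)
    (hx : quadraticChar F (Q x) = (η : ℤ)) (h : HasEvenCount Q (W ⊓ perp Q (F ∙ x)) k s) :
    HasOddCount Q W k (s * η) := by
  have hx0 : Q x ≠ 0 := ne_zero_of_quadraticChar_eq hx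
  have hq : (Fintype.card F : ℤ) ≠ 0 := by exact_mod_cast Fintype.card_ne_zero
  refine ⟨?_, fun c => ?_⟩
  · rw [← finrank_inf_perp_of_map_ne_zero h2 hxW hx0, h.finrank_eq]
  · apply mul_left_cancel₀ hq
    rw [levelCount_eq_sum h2 Q hxW hx0 c]
    push_cast
    rw [Finset.mul_sum]
    simp only [h.count, Finset.sum_add_distrib, ← Finset.sum_mul, ← Finset.mul_sum]
    rw [sum_ite_sub_sq_mul h2 hx0, hx]
    simp only [Finset.sum_const, Finset.card_univ, nsmul_eq_mul]
    ring

omit [Finite V] h2 in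
lemma hasEvenCount_bot (Q : QuadraticForm F V) : HasEvenCount Q ⊥ 0 1 := by
  refine ⟨by simp, fun c => ?_⟩
  rw [levelCount_bot]
  split_ifs <;> simp

/-- The number of vectors on which a nondegenerate form takes a given value, by induction on the
dimension, splitting off a nonsingular vector. -/
theorem exists_count_of_nondegOn (n : ℕ) : ∀ {W : Submodule F V}, NondegOn Q W → finrank F W = n →
    (∀ k, n = 2 * k → ∃ s, HasEvenCount Q W k s) ∧
      (∀ k, n = 2 * k + 1 → ∃ s, HasOddCount Q W k s) := by
  obtain ⟨δ, hδ⟩ := exists_sign_quadraticChar (F := F) (a := -1) (by simp)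
  induction n with
  | zero =>
    intro W _ hn
    refine ⟨fun k hk => ⟨1, ?_⟩, fun k hk => by omega⟩
    obtain rfl : k = 0 := by omega
    rw [Submodule.finrank_eq_zero.1 hn]
    exact hasEvenCount_bot Q
  | succ n ih =>
    intro W hW hn
    obtain ⟨x, hxW, hx⟩ := exists_map_ne_zero hW (fun h => by subst h; simp at hn)
    obtain ⟨η, hη⟩ := exists_sign_quadraticChar hx
    have hfin := finrank_inf_perp_of_map_ne_zero h2 hxW hx
    obtain ⟨h1, h3⟩ := ih (hW.inf_perp h2 hxW hx) (by omega)
    refine ⟨fun k hk => ?_, fun k hk => ?_⟩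
    · obtain ⟨j, rfl⟩ : ∃ j, k = j + 1 := ⟨k - 1, by omega⟩
      obtain ⟨s, hs⟩ := h3 j (by omega)
      exact ⟨_, hasEvenCount_of_perp h2 hδ hxW hη hs⟩
    · obtain ⟨s, hs⟩ := h1 k (by omega)
      exact ⟨_, hasOddCount_of_perp h2 hxW hη hs⟩

lemma HasEvenCount.inf_perp (hW : NondegOn Q W) (hδ : quadraticChar F (-1) = (δ : ℤ)) (hxW : x ∈ W)
    (hx : quadraticChar F (Q x) = (η : ℤ)) (h : HasEvenCount Q W (k + 1) s) :
    HasOddCount Q (W ⊓ perp Q (F ∙ x)) k (s * η * δ) := by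
  have hx0 : Q x ≠ 0 := ne_zero_of_quadraticChar_eq hx
  have hfin := finrank_inf_perp_of_map_ne_zero h2 hxW hx0
  rw [h.finrank_eq] at hfin
  obtain ⟨t, ht⟩ := (exists_count_of_nondegOn h2 _ (hW.inf_perp h2 hxW hx0) rfl).2 k (by omega)
  have := h.sign_unique (hasEvenCount_of_perp h2 hδ hxW hx ht)
  have h3 : s * η * δ = t := by
    rw [this]
    rcases Int.units_eq_one_or η with rfl | rfl <;>
      rcases Int.units_eq_one_or δ with rfl | rfl <;> simp
  rwa [h3]

lemma HasOddCount.inf_perp (hW : NondegOn Q W) (hxW : x ∈ W)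
    (hx : quadraticChar F (Q x) = (η : ℤ)) (h : HasOddCount Q W k s) :
    HasEvenCount Q (W ⊓ perp Q (F ∙ x)) k (s * η) := by
  have hx0 : Q x ≠ 0 := ne_zero_of_quadraticChar_eq hx
  have hfin := finrank_inf_perp_of_map_ne_zero h2 hxW hx0
  rw [h.finrank_eq] at hfin
  obtain ⟨t, ht⟩ := (exists_count_of_nondegOn h2 _ (hW.inf_perp h2 hxW hx0) rfl).1 k (by omega)
  have := h.sign_unique (hasOddCount_of_perp h2 hxW hx ht)
  have h3 : s * η = t := by
    rw [this, mul_assoc]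
    simp
  rwa [h3]

end Counts

section WittIndex

variable {F : Type*} [Field F] [Fintype F] [DecidableEq F]
  {V : Type*} [AddCommGroup V] [Module F V] [Finite V]

/-- The number of singular vectors in `U^⊥`, for `U` maximal totally singular, determines `dim U`:
this number is `|U|` by maximality, and it is determined by the number of singular vectors of the
whole space. -/
lemma HasEvenCount.isEvenType {Q : QuadraticForm F V} (hQ : FormNondegenerate Q)
    {k : ℕ} {s : ℤˣ} (h : HasEvenCount Q ⊤ k s) : IsEvenType Q k s := by
  classical
  have hn : finrank F V = 2 * k := by rw [← h.finrank_eq, finrank_top]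
  set S : Set ℕ := {j | ∃ U : Submodule F V, (∀ u ∈ U, Q u = 0) ∧ finrank F U = j} with hS
  have hbd : ∀ j ∈ S, j ≤ 2 * k := by
    rintro j ⟨U, -, rfl⟩
    rw [← hn]; exact Submodule.finrank_le U
  have hne : S.Nonempty := ⟨0, ⊥, by simp, by simp⟩
  obtain ⟨r, hr⟩ : ∃ r, IsGreatest S r :=
    ⟨_, Nat.sSup_mem hne ⟨2 * k, hbd⟩, fun j hj => le_csSup ⟨2 * k, hbd⟩ hj⟩
  obtain ⟨U, hU, hUr⟩ := hr.1
  have hUU : U ≤ perp Q U := fun v hv => mem_perp_iff.2 fun u hu => by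
    simp [polar, hU _ hu, hU _ hv, hU _ (U.add_mem hu hv)]
  have hfin : finrank F (perp Q U) = 2 * k - r := by
    rw [← hn, ← hUr]; exact LinearMap.BilinForm.finrank_orthogonal hQ U
  have hrk : r ≤ k := by
    have := Submodule.finrank_mono hUU
    have := hbd r hr.1
    omega
  have hcount : levelCount Q (⊤ ⊓ perp Q U) 0 = Fintype.card F ^ r := by
    have : levelCount Q (⊤ ⊓ perp Q U) 0 = Nat.card U := by
      refine Nat.card_congr (Equiv.subtypeEquivRight fun v => ?_)
      rw [top_inf_eq]
      refine ⟨fun hv => ?_, fun hv => ⟨hUU hv, hU v hv⟩⟩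
      by_contra hvU
      have hlt : U < U ⊔ F ∙ v := by
        refine lt_of_le_of_ne le_sup_left fun he => hvU ?_
        rw [he]
        exact le_sup_right (a := U) (Submodule.mem_span_singleton_self v)
      have h1 := Submodule.finrank_lt_finrank_of_lt hlt
      have h3 : finrank F ↥(U ⊔ F ∙ v) ∈ S := by
        refine ⟨_, fun w hw => ?_, rfl⟩
        obtain ⟨u, hu, y, hy, rfl⟩ := Submodule.mem_sup.1 hw
        obtain ⟨a, rfl⟩ := Submodule.mem_span_singleton.1 hy
        rw [add_comm, polar_smul_self_add, hv.2, hU u hu, polar_comm,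
          mem_perp_iff.1 hv.1 u hu]
        ring
      have := hr.2 h3
      omega
    rw [this, Module.natCard_eq_pow_finrank (K := F), hUr, Nat.card_eq_fintype_card]
  have key := card_mul_levelCount_of_singular Q (W := ⊤) le_top hU 0
  rw [hcount, top_inf_eq, Module.natCard_eq_pow_finrank (K := F) (V := perp Q U), hfin,
    Module.natCard_eq_pow_finrank (K := F) (V := (⊤ : Submodule F V)), h.finrank_eq,
    Nat.card_eq_fintype_card] at key
  have hc := h.count 0
  rw [if_pos rfl] at hc
  set q : ℕ := Fintype.card F with hq
  have hq2 : 2 ≤ q := Fintype.one_lt_card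
  obtain ⟨i, rfl⟩ : ∃ i, k = r + i := ⟨k - r, by omega⟩
  -- the equation, divided by `q ^ r`
  have hmain : (s : ℤ) * (q - 1) * q ^ i + q ^ (2 * i) = q := by
    have hpos : (q : ℤ) ^ r ≠ 0 := by positivity
    apply mul_left_cancel₀ hpos
    have e : 2 * (r + i) - r = r + 2 * i := by omega
    rw [e] at key
    zify at key
    rw [hc] at key
    have e1 : (q : ℤ) ^ (r + 2 * i) = q ^ r * q ^ (2 * i) := pow_add _ _ _
    have e2 : (q : ℤ) ^ (r + i) = q ^ r * q ^ i := pow_add _ _ _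
    rw [e1, e2] at key
    linear_combination key
  refine ⟨hQ, hn, ?_⟩
  have hq2' : (2 : ℤ) ≤ q := by exact_mod_cast hq2
  rcases Int.units_eq_one_or s with rfl | rfl
  · left
    refine ⟨rfl, ?_⟩
    rcases Nat.eq_zero_or_pos i with rfl | hi
    · exact hr
    · exfalso
      have h1 : (q : ℤ) ^ 1 ≤ q ^ i := pow_le_pow_right₀ (by omega) hi
      have h3 : (q : ℤ) ^ 1 ≤ q ^ (2 * i) := pow_le_pow_right₀ (by omega) (by omega)
      simp only [Units.val_one] at hmain
      nlinarith
  · right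
    refine ⟨rfl, r, ?_, hr⟩
    simp only [Units.val_neg, Units.val_one] at hmain
    rcases i with _ | _ | i
    · simp at hmain
      omega
    · rfl
    · exfalso
      have e : (q : ℤ) ^ (2 * (i + 1 + 1)) = q ^ (i + 2) * q ^ (i + 2) := by ring
      have h1 : (q : ℤ) ^ 2 ≤ q ^ (i + 2) := pow_le_pow_right₀ (by omega) (by omega)
      have h3 : (q : ℤ) < q ^ (i + 2) := by nlinarith
      have e' : (q : ℤ) ^ (i + 1 + 1) = q ^ (i + 2) := rfl
      rw [e, e'] at hmain
      have h4 : 0 ≤ (q : ℤ) ^ (i + 2) * (q ^ (i + 2) - q) := by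
        apply mul_nonneg <;> linarith
      linarith

end WittIndex

/-! ### Switching and strong regularity -/

section Switching

open Matrix

variable {X : Type*} [Finite X]

lemma stronglyRegular_iff {G : SimpleGraph X} {v k l mu : ℕ} :
    StronglyRegular G v k l mu ↔ Nat.card X = v ∧
      (∀ x, (G.commonNeighbors x x).ncard = k) ∧
      (∀ x y, G.Adj x y → (G.commonNeighbors x y).ncard = l) ∧
      ∀ x y, x ≠ y → ¬ G.Adj x y → (G.commonNeighbors x y).ncard = mu := by
  classical
  let _ : Fintype X := Fintype.ofFinite X
  have hself : ∀ x, (G.commonNeighbors x x).ncard = G.degree x := fun x => by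
    rw [← SimpleGraph.card_neighborSet_eq_degree, ← Nat.card_eq_fintype_card,
      SimpleGraph.commonNeighbors, Set.inter_self, Nat.card_coe_set_eq]
  constructor
  · intro h
    refine ⟨?_, fun x => ?_, fun x y hxy => ?_, fun x y hne hxy => ?_⟩
    · rw [← h.card, Nat.card_eq_fintype_card]
    · rw [hself]; convert h.regular x
    · rw [← h.of_adj x y hxy, ← Nat.card_coe_set_eq, Nat.card_eq_fintype_card]
    · rw [← h.of_not_adj hne hxy, ← Nat.card_coe_set_eq, Nat.card_eq_fintype_card]
  · rintro ⟨h1, h2, h3, h4⟩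
    unfold StronglyRegular
    refine ⟨?_, fun x => ?_, fun x y hxy => ?_, fun x y hne hxy => ?_⟩
    · rw [← h1, Nat.card_eq_fintype_card]
    · rw [← h2 x, hself]
    · rw [← h3 x y hxy, ← Nat.card_coe_set_eq, Nat.card_eq_fintype_card]
    · rw [← h4 x y hne hxy, ← Nat.card_coe_set_eq, Nat.card_eq_fintype_card]

omit [Finite X] in
open Classical in
lemma sum_adj_indicator [Fintype X] (G : SimpleGraph X) (x : X) (S : Set X) :
    ∑ y, G.adjMatrix ℚ x y * S.indicator 1 y = ((nbrIn G x S).ncard : ℚ) := by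
  rw [← Nat.card_coe_set_eq, Nat.card_eq_fintype_card, Fintype.card_subtype, Finset.card_filter,
    Nat.cast_sum]
  refine Finset.sum_congr rfl fun y _ => ?_
  simp only [SimpleGraph.adjMatrix_apply, nbrIn, Set.mem_inter_iff, SimpleGraph.mem_neighborSet,
    Set.indicator, Pi.one_apply]
  by_cases h1 : G.Adj x y <;> by_cases h2 : y ∈ S <;> simp [h1, h2]

open Classical in
lemma stronglyRegular_iff_matrix [Fintype X] {G : SimpleGraph X} {v k l mu : ℕ} :
    StronglyRegular G v k l mu ↔ Nat.card X = v ∧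
      G.adjMatrix ℚ * G.adjMatrix ℚ = (k : ℚ) • (1 : Matrix X X ℚ) + (l : ℚ) • G.adjMatrix ℚ +
        (mu : ℚ) • (Matrix.of (fun _ _ => 1) - 1 - G.adjMatrix ℚ) := by
  have hAA : ∀ x y, (G.adjMatrix ℚ * G.adjMatrix ℚ) x y =
      ((G.commonNeighbors x y).ncard : ℚ) := by
    intro x y
    rw [Matrix.mul_apply,
      show G.commonNeighbors x y = nbrIn G x (G.neighborSet y) from rfl, ← sum_adj_indicator]
    refine Finset.sum_congr rfl fun z _ => ?_
    simp [Set.indicator, SimpleGraph.adjMatrix_apply, G.adj_comm z y]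
  rw [stronglyRegular_iff]
  refine and_congr_right fun _ => ⟨fun ⟨h1, h2, h3⟩ => ?_, fun h => ?_⟩
  · ext x y
    rw [hAA]
    rcases eq_or_ne x y with rfl | hne
    · simp [h1]
    · by_cases hxy : G.Adj x y
      · simp [h2 x y hxy, hne, hxy]
      · simp [h3 x y hne hxy, hne, hxy]
  · refine ⟨fun x => ?_, fun x y hxy => ?_, fun x y hne hxy => ?_⟩
    · have := hAA x x
      rw [h] at this
      simp at this
      exact_mod_cast this.symm
    · have := hAA x y
      rw [h] at this
      simp [hxy, hxy.ne] at this
      exact_mod_cast this.symm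
    · have := hAA x y
      rw [h] at this
      simp [hxy, hne] at this
      exact_mod_cast this.symm

open Classical in
/-- Switching conjugates the adjacency matrix by the reflection `1 - (1 / m) w wᵀ`, where
`w = 1_{C₁} - 1_{C₂}` and `m = |C₁| = |C₂|`. -/
lemma adjMatrix_switchedGraph [Fintype X] {G : SimpleGraph X} {C₁ C₂ : Set X}
    (h : IsSwitchingSet G C₁ C₂) (hne : C₁.Nonempty) :
    ∃ U : Matrix X X ℚ, U * U = 1 ∧ U * Matrix.of (fun _ _ => 1) = Matrix.of (fun _ _ => 1) ∧
      Matrix.of (fun _ _ => 1) * U = Matrix.of (fun _ _ => 1) ∧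
      (switchedGraph G C₁ C₂).adjMatrix ℚ = U * G.adjMatrix ℚ * U := by
  obtain ⟨a, ha₁, ha₂⟩ := h.regular_parts
  obtain ⟨b, hb⟩ := h.regular_union
  have hdisj := Set.disjoint_left.1 h.disjoint
  set m : ℚ := (C₁.ncard : ℚ) with hm
  have hm2 : m = (C₂.ncard : ℚ) := by rw [hm, h.card_eq]
  have hmpos : 0 < C₁.ncard := (Set.ncard_pos (Set.toFinite _)).2 hne
  have hm0 : m ≠ 0 := by rw [hm]; exact_mod_cast hmpos.ne'
  set w : X → ℚ := fun x => C₁.indicator 1 x - C₂.indicator 1 x with hw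
  set A := G.adjMatrix ℚ with hA
  have hAsymm : ∀ x y, A x y = A y x := fun x y => by
    simp [hA, SimpleGraph.adjMatrix_apply, G.adj_comm]
  have hw1 : ∀ x ∈ C₁, w x = 1 := fun x hx => by
    simp [hw, hx, hdisj hx]
  have hw2 : ∀ x ∈ C₂, w x = -1 := fun x hx => by
    have : x ∉ C₁ := fun h' => hdisj h' hx
    simp [hw, hx, this]
  have hw0 : ∀ x, x ∉ C₁ ∪ C₂ → w x = 0 := fun x hx => by
    simp only [Set.mem_union, not_or] at hx
    simp [hw, hx.1, hx.2]
  have hcard : ∀ S : Set X, ∑ y, S.indicator (1 : X → ℚ) y = S.ncard := fun S => by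
    rw [← Nat.card_coe_set_eq, Nat.card_eq_fintype_card, Fintype.card_subtype, Finset.card_filter,
      Nat.cast_sum]
    refine Finset.sum_congr rfl fun y _ => ?_
    by_cases h2 : y ∈ S <;> simp [h2]
  have hwsum : ∑ y, w y = 0 := by
    simp only [hw, Finset.sum_sub_distrib, hcard]
    rw [h.card_eq, sub_self]
  have hwsq : ∑ y, w y * w y = 2 * m := by
    have : ∀ y, w y * w y = C₁.indicator 1 y + C₂.indicator 1 y := by
      intro y
      by_cases h1 : y ∈ C₁
      · rw [hw1 y h1]; simp [h1, hdisj h1]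
      · by_cases h2 : y ∈ C₂
        · rw [hw2 y h2]; simp [h1, h2]
        · rw [hw0 y (by simp [h1, h2])]; simp [h1, h2]
    rw [Finset.sum_congr rfl fun y _ => this y, Finset.sum_add_distrib, hcard, hcard, ← hm2]
    ring
  -- `t = A w`
  set t : X → ℚ := fun x => ∑ y, A x y * w y with ht
  have htx : ∀ x, t x = ((nbrIn G x C₁).ncard : ℚ) - (nbrIn G x C₂).ncard := fun x => by
    simp only [ht, hw, mul_sub, Finset.sum_sub_distrib, ← sum_adj_indicator, hA]
  have hunion : ∀ x, (nbrIn G x (C₁ ∪ C₂)).ncard =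
      (nbrIn G x C₁).ncard + (nbrIn G x C₂).ncard := fun x => by
    unfold nbrIn
    rw [Set.inter_union_distrib_left]
    exact Set.ncard_union_eq (h.disjoint.mono Set.inter_subset_right Set.inter_subset_right)
  set κ : ℚ := 2 * a - b with hκ
  have htC : ∀ x ∈ C₁ ∪ C₂, t x = κ * w x := by
    intro x hx
    have e := hb x hx
    rw [hunion] at e
    rw [htx, hκ, ← e]
    rcases hx with hx | hx
    · rw [hw1 x hx, ha₁ x hx]; push_cast; ring
    · rw [hw2 x hx, ha₂ x hx]; push_cast; ring
  have hwt : ∑ x, w x * t x = κ * (2 * m) := by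
    rw [← hwsq, Finset.mul_sum]
    refine Finset.sum_congr rfl fun x _ => ?_
    by_cases hx : x ∈ C₁ ∪ C₂
    · rw [htC x hx]; ring
    · rw [hw0 x hx]; ring
  refine ⟨1 - (1 / m) • vecMulVec w w, ?_, ?_, ?_, ?_⟩
  · have : vecMulVec w w * vecMulVec w w = (2 * m) • vecMulVec w w := by
      ext x y
      rw [Matrix.mul_apply, Matrix.smul_apply, ← hwsq, smul_eq_mul, Finset.sum_mul]
      refine Finset.sum_congr rfl fun z _ => ?_
      simp only [vecMulVec_apply]; ring
    rw [sub_mul, mul_sub, mul_sub, Matrix.smul_mul, Matrix.smul_mul, Matrix.mul_smul,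
      Matrix.mul_smul, this, smul_smul, smul_smul]
    have e : 1 / m * (1 / m) * (2 * m) = 1 / m + 1 / m := by field_simp; norm_num
    rw [e, add_smul]
    simp
  · rw [sub_mul, one_mul, Matrix.smul_mul, sub_eq_self]
    ext x y
    simp [Matrix.mul_apply, vecMulVec_apply, ← Finset.mul_sum, hwsum]
  · rw [mul_sub, mul_one, Matrix.mul_smul, sub_eq_self]
    ext x y
    simp [Matrix.mul_apply, vecMulVec_apply, ← Finset.sum_mul, hwsum]
  · have e1 : A * vecMulVec w w = vecMulVec t w := by
      ext x y
      simp only [Matrix.mul_apply, vecMulVec_apply, ht, Finset.sum_mul, mul_assoc]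
    have e2 : vecMulVec w w * A = vecMulVec w t := by
      ext x y
      simp only [Matrix.mul_apply, vecMulVec_apply, ht, Finset.mul_sum]
      refine Finset.sum_congr rfl fun z _ => ?_
      rw [hAsymm z y]; ring
    have e3 : vecMulVec w w * vecMulVec t w = (κ * (2 * m)) • vecMulVec w w := by
      ext x y
      simp only [Matrix.mul_apply, vecMulVec_apply, Matrix.smul_apply, smul_eq_mul, ← hwt,
        Finset.sum_mul]
      refine Finset.sum_congr rfl fun z _ => ?_
      ring
    have e4 : (1 - (1 / m) • vecMulVec w w) * A * (1 - (1 / m) • vecMulVec w w) =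
        A - (1 / m) • vecMulVec t w - (1 / m) • vecMulVec w t +
          (2 * κ / m) • vecMulVec w w := by
      rw [mul_assoc, mul_sub, mul_one, Matrix.mul_smul, e1, sub_mul, one_mul, mul_sub,
        Matrix.smul_mul, Matrix.smul_mul, Matrix.mul_smul, e2, e3, smul_smul, smul_smul]
      have e : 1 / m * (1 / m) * (κ * (2 * m)) = 2 * κ / m := by field_simp
      rw [e]
      abel
    rw [e4]
    -- an outside vertex and a vertex of `C₁ ∪ C₂`
    have mixed : ∀ x, x ∉ C₁ ∪ C₂ → ∀ y ∈ C₁ ∪ C₂,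
        (if y ∈ switchedNbr G C₁ C₂ x then (1 : ℚ) else 0) = A x y - 1 / m * (t x * w y) := by
      intro x hx y hy
      have hAxy : A x y = if y ∈ nbrIn G x (C₁ ∪ C₂) then 1 else 0 := by
        rw [hA, SimpleGraph.adjMatrix_apply]
        simp only [nbrIn, Set.mem_inter_iff, SimpleGraph.mem_neighborSet, hy, and_true]
      have hsub : ∀ S ⊆ C₁ ∪ C₂, nbrIn G x S = nbrIn G x (C₁ ∪ C₂) ∩ S := fun S hS => by
        ext z
        simp only [nbrIn, Set.mem_inter_iff]
        exact ⟨fun h => ⟨⟨h.1, hS h.2⟩, h.2⟩, fun h => ⟨h.1.1, h.2⟩⟩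
      have hn1 := hsub C₁ Set.subset_union_left
      have hn2 := hsub C₂ Set.subset_union_right
      have hi : C₁ ∩ C₂ = ∅ := h.disjoint.inter_eq
      have hi' : C₂ ∩ C₁ = ∅ := by rw [Set.inter_comm, hi]
      have hC12 : C₁ ≠ C₂ := fun hC => by
        rw [← hC, Set.inter_self] at hi
        exact hne.ne_empty hi
      by_cases hc2 : nbrIn G x (C₁ ∪ C₂) = C₂
      · have hs : switchedNbr G C₁ C₂ x = C₁ := if_pos hc2
        rw [htx, hn1, hn2, hAxy, hs, hc2, hi', Set.inter_self, ← hm2]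
        rcases hy with hy | hy
        · rw [hw1 y hy]
          simp [hy, hdisj hy, hm0]
        · rw [hw2 y hy]
          have : y ∉ C₁ := fun h' => hdisj h' hy
          simp [hy, this, hm0]
      by_cases hc1 : nbrIn G x (C₁ ∪ C₂) = C₁
      · have hs : switchedNbr G C₁ C₂ x = C₂ := by
          rw [switchedNbr, if_neg hc2, if_pos hc1]
        rw [htx, hn1, hn2, hAxy, hs, hc1, hi, Set.inter_self, ← hm]
        rcases hy with hy | hy
        · rw [hw1 y hy]
          simp [hy, hdisj hy, hm0]
        · rw [hw2 y hy]
          have : y ∉ C₁ := fun h' => hdisj h' hy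
          simp [hy, this, hm0]
      · have hs : switchedNbr G C₁ C₂ x = nbrIn G x (C₁ ∪ C₂) := by
          rw [switchedNbr, if_neg hc2, if_neg hc1]
        have ht0 : t x = 0 := by
          rcases h.outside x hx with h' | h' | h'
          · rw [htx, h', sub_self]
          · exact absurd h' hc1
          · exact absurd h' hc2
        rw [hs, hAxy, ht0]
        ring
    ext x y
    simp only [SimpleGraph.adjMatrix_apply, Matrix.add_apply, Matrix.sub_apply, Matrix.smul_apply,
      vecMulVec_apply, smul_eq_mul]
    by_cases hx : x ∈ C₁ ∪ C₂ <;> by_cases hy : y ∈ C₁ ∪ C₂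
    · have : (switchedGraph G C₁ C₂).Adj x y ↔ G.Adj x y := by
        simp only [switchedGraph, hx, hy, not_true, false_and, or_false, true_and]
      rw [htC x hx, htC y hy, if_congr this rfl rfl, ← SimpleGraph.adjMatrix_apply]
      ring
    · have : (switchedGraph G C₁ C₂).Adj x y ↔ x ∈ switchedNbr G C₁ C₂ y := by
        simp only [switchedGraph, hx, hy, not_true, false_and, false_or, true_and, iff_false,
          not_false_iff]
      rw [hw0 y hy, if_congr this rfl rfl, mixed y hy x hx, hAsymm x y]
      ring
    · have : (switchedGraph G C₁ C₂).Adj x y ↔ y ∈ switchedNbr G C₁ C₂ x := by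
        simp only [switchedGraph, hx, hy, not_true, false_and, false_or, true_and, false_iff,
          not_false_iff, or_false]
      rw [hw0 x hx, if_congr this rfl rfl, mixed x hx y hy]
      ring
    · have : (switchedGraph G C₁ C₂).Adj x y ↔ G.Adj x y := by
        simp only [switchedGraph, hx, hy, false_and, and_false, or_false, true_and]
      rw [hw0 x hx, hw0 y hy, if_congr this rfl rfl, ← SimpleGraph.adjMatrix_apply]
      ring

/-- Switching preserves strong regularity and the parameters. -/
theorem StronglyRegular.switchedGraph {G : SimpleGraph X} {C₁ C₂ : Set X} {v k l mu : ℕ}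
    (hG : StronglyRegular G v k l mu) (h : IsSwitchingSet G C₁ C₂) (hne : C₁.Nonempty) :
    StronglyRegular (switchedGraph G C₁ C₂) v k l mu := by
  classical
  let _ : Fintype X := Fintype.ofFinite X
  rw [stronglyRegular_iff_matrix] at hG ⊢
  refine ⟨hG.1, ?_⟩
  obtain ⟨U, hUU, hUJ, hJU, hA⟩ := adjMatrix_switchedGraph h hne
  set A := G.adjMatrix ℚ
  set J : Matrix X X ℚ := Matrix.of (fun _ _ => 1)
  have e : U * A * U * (U * A * U) = U * (A * A) * U := by
    calc U * A * U * (U * A * U) = U * A * (U * U) * A * U := by simp only [mul_assoc]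
      _ = U * (A * A) * U := by rw [hUU]; simp only [mul_assoc, mul_one]
  have eJ : U * J * U = J := by rw [hUJ, hJU]
  rw [hA, e, hG.2]
  simp only [mul_add, add_mul, mul_sub, sub_mul, Matrix.mul_smul, Matrix.smul_mul, mul_one, hUU, eJ]

end Switching

/-! ### Points of a class -/

section Points

variable {F : Type*} [Field F] [Fintype F] [DecidableEq F]
  {V : Type*} [AddCommGroup V] [Module F V]

lemma quadraticChar_map_smul (Q : QuadraticForm F V) {a : F} (ha : a ≠ 0) (v : V) :
    quadraticChar F (Q (a • v)) = quadraticChar F (Q v) := by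
  rw [QuadraticMap.map_smul, smul_eq_mul, ← _root_.sq, map_mul, quadraticChar_sq_one' ha, one_mul]

lemma map_ne_zero_of_class {Q : QuadraticForm F V} {ε : ℤˣ} {v : V}
    (hv : quadraticChar F (Q v) = (ε : ℤ)) : Q v ≠ 0 :=
  ne_zero_of_quadraticChar_eq hv

lemma quadraticChar_div_eq_one {ε : ℤˣ} {a b : F} (ha : quadraticChar F a = (ε : ℤ))
    (hb : quadraticChar F b = (ε : ℤ)) : quadraticChar F (a / b) = 1 := by
  have hb0 : b ≠ 0 := ne_zero_of_quadraticChar_eq hb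
  have : quadraticChar F (a / b) * ε = ε := by
    rw [← hb, ← map_mul, div_mul_cancel₀ _ hb0, ha, hb]
  exact mul_right_cancel₀ ε.ne_zero (by rw [this, one_mul])

lemma ne_zero_of_class {Q : QuadraticForm F V} {ε : ℤˣ} {v : V}
    (hv : quadraticChar F (Q v) = (ε : ℤ)) : v ≠ 0 :=
  fun h0 => map_ne_zero_of_class hv (by simp [h0])

omit [Fintype F] [DecidableEq F] in
lemma exists_rep_mk_eq_smul {v : V} (hv : v ≠ 0) :
    ∃ a : F, a ≠ 0 ∧ (Projectivization.mk F v hv).rep = a • v := by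
  obtain ⟨a, ha⟩ := Projectivization.exists_smul_eq_mk_rep F v hv
  exact ⟨a, a.ne_zero, ha.symm⟩

/-- The vertex represented by a vector of class `ε`. -/
def classPoint (Q : QuadraticForm F V) {ε : ℤˣ} (v : V)
    (hv : quadraticChar F (Q v) = (ε : ℤ)) : ClassPoint Q ε :=
  ⟨Projectivization.mk F v (ne_zero_of_class hv), by
    obtain ⟨a, ha, h⟩ := exists_rep_mk_eq_smul (F := F) (ne_zero_of_class hv)
    rw [h, quadraticChar_map_smul Q ha, hv]⟩

variable {Q : QuadraticForm F V} {ε : ℤˣ}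

lemma exists_rep_classPoint (v : V) (hv : quadraticChar F (Q v) = (ε : ℤ)) :
    ∃ a : F, a ≠ 0 ∧ (classPoint Q v hv).1.rep = a • v :=
  exists_rep_mk_eq_smul _

lemma classPoint_rep (x : ClassPoint Q ε) : classPoint Q x.1.rep x.2 = x :=
  Subtype.ext (Projectivization.mk_rep _)

lemma classPoint_eq_iff {v w : V} (hv : quadraticChar F (Q v) = (ε : ℤ))
    (hw : quadraticChar F (Q w) = (ε : ℤ)) :
    classPoint Q v hv = classPoint Q w hw ↔ ∃ a : F, a • w = v := by
  rw [Subtype.ext_iff]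
  exact Projectivization.mk_eq_mk_iff' F v w _ _

omit [Fintype F] [DecidableEq F] in
lemma submodule_le_iff {x : ℙ F V} {L : Submodule F V} : x.submodule ≤ L ↔ x.rep ∈ L := by
  rw [Projectivization.submodule_eq, Submodule.span_singleton_le_iff_mem]

lemma rep_classPoint_mem_iff {v : V} (hv : quadraticChar F (Q v) = (ε : ℤ))
    {L : Submodule F V} : (classPoint Q v hv).1.rep ∈ L ↔ v ∈ L := by
  obtain ⟨a, ha, h⟩ := exists_rep_classPoint v hv
  rw [h, Submodule.smul_mem_iff L ha]

lemma polar_rep_classPoint_eq_zero_iff {v : V} (hv : quadraticChar F (Q v) = (ε : ℤ)) (w : V) :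
    polar Q (classPoint Q v hv).1.rep w = 0 ↔ polar Q v w = 0 := by
  obtain ⟨a, ha, h⟩ := exists_rep_classPoint v hv
  rw [h, polar_smul_left, smul_eq_zero, or_iff_right ha]

/-- Every point of class `χ c` carries exactly two vectors on which `Q` takes the value `c`. -/
lemma two_mul_card_points [Finite V] (h2 : (2 : F) ≠ 0) (W : Submodule F V) {c : F}
    (hc : quadraticChar F c = (ε : ℤ)) :
    2 * Nat.card {x : ClassPoint Q ε // x.1.rep ∈ W} = levelCount Q W c := by
  classical
  have hc0 : c ≠ 0 := ne_zero_of_quadraticChar_eq hc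
  have hfin : Finite (ClassPoint Q ε) := by
    have : Finite (ℙ F V) := Quotient.finite _
    infer_instance
  let _ : Fintype {x : ClassPoint Q ε // x.1.rep ∈ W} := Fintype.ofFinite _
  have h1 : ∀ x : {x : ClassPoint Q ε // x.1.rep ∈ W},
      Nat.card {a : F // a ^ 2 = c / Q x.1.1.rep} = 2 := by
    intro x
    have h := quadraticChar_card_sqrts (ringChar_ne_two_of_two_ne_zero h2) (c / Q x.1.1.rep)
    rw [quadraticChar_div_eq_one hc x.1.2] at h
    rw [Nat.card_eq_fintype_card, Fintype.card_subtype]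
    zify
    refine Eq.trans ?_ h
    congr 2
    ext
    simp
  have h3 : levelCount Q W c =
      Nat.card (Σ x : {x : ClassPoint Q ε // x.1.rep ∈ W}, {a : F // a ^ 2 = c / Q x.1.1.rep}) := by
    symm
    refine Nat.card_eq_of_bijective (fun p => ⟨p.2.1 • p.1.1.1.rep, W.smul_mem _ p.1.2, ?_⟩)
      ⟨?_, ?_⟩
    · rw [QuadraticMap.map_smul, smul_eq_mul, ← _root_.sq, p.2.2,
        div_mul_cancel₀ _ (map_ne_zero_of_class p.1.1.2)]
    · rintro ⟨⟨x, hx⟩, a, ha⟩ ⟨⟨y, hy⟩, b, hb⟩ h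
      have h' : a • x.1.rep = b • y.1.rep := congrArg Subtype.val h
      have ha0 : a ≠ 0 := by
        rintro rfl
        refine div_ne_zero hc0 (map_ne_zero_of_class x.2) ?_
        rw [← ha]; ring
      have hxy : x = y := by
        rw [← classPoint_rep x, ← classPoint_rep y, classPoint_eq_iff]
        exact ⟨a⁻¹ * b, by rw [mul_smul, ← h', smul_smul, inv_mul_cancel₀ ha0, one_smul]⟩
      subst hxy
      have hab : a = b := by
        have : (a - b) • x.1.rep = 0 := by rw [sub_smul, h', sub_self]
        rcases smul_eq_zero.1 this with h0 | h0
        · exact sub_eq_zero.1 h0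
        · exact absurd h0 x.1.rep_nonzero
      subst hab
      rfl
    · rintro ⟨v, hv, hvc⟩
      have hvε : quadraticChar F (Q v) = (ε : ℤ) := by rw [hvc, hc]
      obtain ⟨a, ha, h⟩ := exists_rep_classPoint v hvε
      refine ⟨⟨⟨classPoint Q v hvε, (rep_classPoint_mem_iff hvε).2 hv⟩, a⁻¹, ?_⟩, ?_⟩
      · simp only [h, QuadraticMap.map_smul, hvc, smul_eq_mul]
        field_simp
      · simp [h, smul_smul, inv_mul_cancel₀ ha]
  rw [h3, Nat.card_sigma, Finset.sum_congr rfl fun x _ => h1 x]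
  simp [mul_comm]

lemma orthGraph_adj_iff (h2 : (2 : F) ≠ 0) {x y : ClassPoint Q ε} :
    (orthGraph Q ε).Adj x y ↔ polar Q x.1.rep y.1.rep = 0 := by
  refine ⟨fun h => h.2, fun h => ⟨?_, h⟩⟩
  rintro rfl
  rw [polar_self_eq] at h
  exact mul_ne_zero h2 (map_ne_zero_of_class x.2) h

lemma adj_classPoint_left (h2 : (2 : F) ≠ 0) {v : V} (hv : quadraticChar F (Q v) = (ε : ℤ))
    {y : ClassPoint Q ε} :
    (orthGraph Q ε).Adj (classPoint Q v hv) y ↔ polar Q v y.1.rep = 0 := by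
  rw [orthGraph_adj_iff h2, polar_rep_classPoint_eq_zero_iff]

lemma adj_classPoint_right (h2 : (2 : F) ≠ 0) {v : V} (hv : quadraticChar F (Q v) = (ε : ℤ))
    {y : ClassPoint Q ε} :
    (orthGraph Q ε).Adj y (classPoint Q v hv) ↔ polar Q y.1.rep v = 0 := by
  rw [SimpleGraph.adj_comm, adj_classPoint_left h2, polar_comm]

/-- The parameters of `Γ_ε`, read off from the numbers of vectors with a given value in the
subspaces `V`, `x^⊥` and `⟨x, y⟩^⊥`. -/
lemma stronglyRegular_orthGraph [Finite V] (h2 : (2 : F) ≠ 0) {c : F}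
    (hc : quadraticChar F c = (ε : ℤ)) {v k l mu : ℕ} (hv : levelCount Q ⊤ c = 2 * v)
    (hk : ∀ x, quadraticChar F (Q x) = (ε : ℤ) → levelCount Q (⊤ ⊓ perp Q (F ∙ x)) c = 2 * k)
    (hl : ∀ x y, quadraticChar F (Q x) = (ε : ℤ) → quadraticChar F (Q y) = (ε : ℤ) →
      polar Q x y = 0 → levelCount Q (⊤ ⊓ perp Q (F ∙ x) ⊓ perp Q (F ∙ y)) c = 2 * l)
    (hmu : ∀ x y, quadraticChar F (Q x) = (ε : ℤ) → quadraticChar F (Q y) = (ε : ℤ) →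
      polar Q x y ≠ 0 → (∀ a : F, a • x ≠ y) →
      levelCount Q (⊤ ⊓ perp Q (F ∙ x) ⊓ perp Q (F ∙ y)) c = 2 * mu) :
    StronglyRegular (orthGraph Q ε) v k l mu := by
  have hcommon : ∀ x y : ClassPoint Q ε, 2 * ((orthGraph Q ε).commonNeighbors x y).ncard =
      levelCount Q (⊤ ⊓ perp Q (F ∙ x.1.rep) ⊓ perp Q (F ∙ y.1.rep)) c := by
    intro x y
    rw [← two_mul_card_points h2 _ hc, ← Nat.card_coe_set_eq]
    congr 1
    refine Nat.card_congr (Equiv.subtypeEquivRight fun z => ?_)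
    rw [Submodule.mem_inf, Submodule.mem_inf, mem_perp_span_singleton, mem_perp_span_singleton,
      ← orthGraph_adj_iff h2, ← orthGraph_adj_iff h2]
    simp [SimpleGraph.mem_commonNeighbors]
  rw [stronglyRegular_iff]
  refine ⟨?_, fun x => ?_, fun x y hxy => ?_, fun x y hne hxy => ?_⟩
  · have : Nat.card {x : ClassPoint Q ε // x.1.rep ∈ (⊤ : Submodule F V)} =
        Nat.card (ClassPoint Q ε) := by
      refine Nat.card_congr (Equiv.subtypeUnivEquiv fun x => Submodule.mem_top)
    have := two_mul_card_points (Q := Q) h2 ⊤ hc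
    omega
  · have h1 := hcommon x x
    rw [inf_assoc, inf_idem, hk _ x.2] at h1
    omega
  · have h1 := hcommon x y
    rw [hl _ _ x.2 y.2 ((orthGraph_adj_iff h2).1 hxy)] at h1
    omega
  · have h1 := hcommon x y
    rw [hmu _ _ x.2 y.2 (fun h => hxy ((orthGraph_adj_iff h2).2 h)) (fun a ha => hne ?_)] at h1
    · omega
    · rw [← classPoint_rep x, ← classPoint_rep y, eq_comm, classPoint_eq_iff]
      exact ⟨a, ha⟩

end Points

/-! ### Switching pairs -/

section SwitchingPairs

variable {F : Type*} [Field F] [Fintype F] [DecidableEq F]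
  {V : Type*} [AddCommGroup V] [Module F V] {Q : QuadraticForm F V} {ε : ℤˣ} {m : ℕ}
  {L₁ L₂ : Submodule F V}

lemma IsSwitchingPair.symm (h : IsSwitchingPair Q ε m L₁ L₂) : IsSwitchingPair Q ε m L₂ L₁ where
  finrank_left := h.finrank_right
  finrank_right := h.finrank_left
  finrank_inf := by rw [inf_comm]; exact h.finrank_inf
  radical_left := by rw [inf_comm L₂ L₁]; exact h.radical_right
  radical_right := by rw [inf_comm L₂ L₁]; exact h.radical_left
  type_left := h.type_right
  type_right := h.type_left

lemma IsSwitchingPair.polar_eq_zero (h : IsSwitchingPair Q ε m L₁ L₂) {u v : V}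
    (hu : u ∈ L₁ ⊓ L₂) (hv : v ∈ L₁) : polar Q v u = 0 := by
  rw [← h.radical_left] at hu
  exact mem_perp_iff.1 hu.2 v hv

lemma IsSwitchingPair.polar_eq_zero' (h : IsSwitchingPair Q ε m L₁ L₂) {u v : V}
    (hu : u ∈ L₁ ⊓ L₂) (hv : v ∈ L₂) : polar Q v u = 0 :=
  h.symm.polar_eq_zero (by rwa [inf_comm]) hv

lemma mem_pointDiff_iff {L L' : Submodule F V} {y : ClassPoint Q ε} :
    y ∈ pointDiff Q ε L L' ↔ y.1.rep ∈ L ∧ y.1.rep ∉ L' := by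
  simp only [pointDiff, Set.mem_ofPred_eq, submodule_le_iff]

lemma IsSwitchingPair.exists_mem (h : IsSwitchingPair Q ε m L₁ L₂) :
    ∃ x ∈ L₁, x ∉ L₂ ∧ quadraticChar F (Q x) = (ε : ℤ) := by
  have hlt : ¬ L₁ ≤ L₂ := by
    intro hle
    have h1 := h.finrank_left
    have h3 := h.finrank_inf
    rw [inf_eq_left.2 hle] at h3
    omega
  obtain ⟨x, hx1, hx2⟩ := SetLike.not_le_iff_exists.1 hlt
  have hx0 : x ≠ 0 := by rintro rfl; exact hx2 L₂.zero_mem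
  refine ⟨x, hx1, hx2, ?_⟩
  obtain ⟨a, ha, hr⟩ := exists_rep_mk_eq_smul (F := F) hx0
  rw [← quadraticChar_map_smul Q ha, ← hr]
  apply h.type_left
  · rw [submodule_le_iff, hr]; exact L₁.smul_mem _ hx1
  · rwa [submodule_le_iff, hr, Submodule.smul_mem_iff _ ha]

variable [Finite V]

lemma IsSwitchingPair.exists_decomp (h : IsSwitchingPair Q ε m L₁ L₂) {x v : V} (hx : x ∈ L₁)
    (hx' : x ∉ L₂) (hv : v ∈ L₁) : ∃ a : F, ∃ u ∈ L₁ ⊓ L₂, v = a • x + u := by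
  have hlt : L₁ ⊓ L₂ < (L₁ ⊓ L₂) ⊔ F ∙ x := by
    refine lt_of_le_of_ne le_sup_left fun he => hx' ?_
    have : x ∈ (L₁ ⊓ L₂) ⊔ F ∙ x := le_sup_right (a := L₁ ⊓ L₂)
      (Submodule.mem_span_singleton_self x)
    rw [← he] at this
    exact this.2
  have hle : (L₁ ⊓ L₂) ⊔ F ∙ x ≤ L₁ :=
    sup_le inf_le_left ((Submodule.span_singleton_le_iff_mem _ _).2 hx)
  have heq : (L₁ ⊓ L₂) ⊔ F ∙ x = L₁ := by
    apply Submodule.eq_of_le_of_finrank_le hle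
    have h1 := Submodule.finrank_lt_finrank_of_lt hlt
    have h3 := h.finrank_left
    have h4 := h.finrank_inf
    omega
  rw [← heq] at hv
  obtain ⟨u, hu, y, hy, rfl⟩ := Submodule.mem_sup.1 hv
  obtain ⟨a, rfl⟩ := Submodule.mem_span_singleton.1 hy
  exact ⟨a, u, hu, add_comm _ _⟩

omit [Fintype F] [DecidableEq F] [Finite V] in
lemma add_mem_left_not_mem_right {x u : V} (hx : x ∈ L₁) (hx' : x ∉ L₂) (hu : u ∈ L₁ ⊓ L₂) :
    x + u ∈ L₁ ∧ x + u ∉ L₂ :=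
  ⟨L₁.add_mem hx hu.1, fun hc => hx' (by simpa using L₂.sub_mem hc hu.2)⟩

variable (h2 : (2 : F) ≠ 0)
include h2

omit [Finite V] in
lemma IsSwitchingPair.map_inf_eq_zero (h : IsSwitchingPair Q ε m L₁ L₂) {u : V}
    (hu : u ∈ L₁ ⊓ L₂) : Q u = 0 := by
  have := h.polar_eq_zero hu hu.1
  rw [polar_self_eq] at this
  exact (mul_eq_zero.1 this).resolve_left h2

omit [Finite V] in
lemma IsSwitchingPair.class_add (h : IsSwitchingPair Q ε m L₁ L₂) {x u : V} (hx : x ∈ L₁)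
    (hxε : quadraticChar F (Q x) = (ε : ℤ)) (hu : u ∈ L₁ ⊓ L₂) :
    quadraticChar F (Q (x + u)) = (ε : ℤ) := by
  rw [QuadraticMap.map_add Q, h.polar_eq_zero hu hx, h.map_inf_eq_zero h2 hu, add_zero, add_zero,
    hxε]

/-- The points of `L₁ ∖ L₂` are the points `⟨x + u⟩` with `u ∈ L₁ ∩ L₂`. -/
lemma IsSwitchingPair.mem_pointDiff_iff_exists (h : IsSwitchingPair Q ε m L₁ L₂) {x : V}
    (hx : x ∈ L₁) (hx' : x ∉ L₂) (hxε : quadraticChar F (Q x) = (ε : ℤ)) {y : ClassPoint Q ε} :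
    y ∈ pointDiff Q ε L₁ L₂ ↔
      ∃ u, ∃ hu : u ∈ L₁ ⊓ L₂, y = classPoint Q (x + u) (h.class_add h2 hx hxε hu) := by
  rw [mem_pointDiff_iff]
  constructor
  · rintro ⟨hy, hy'⟩
    obtain ⟨a, u, hu, he⟩ := h.exists_decomp hx hx' hy
    have ha : a ≠ 0 := by
      rintro rfl
      rw [zero_smul, zero_add] at he
      exact hy' (he ▸ hu.2)
    refine ⟨a⁻¹ • u, Submodule.smul_mem _ _ hu, ?_⟩
    conv_lhs => rw [← classPoint_rep y]
    rw [classPoint_eq_iff]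
    refine ⟨a, ?_⟩
    rw [smul_add, smul_smul, mul_inv_cancel₀ ha, one_smul, he]
  · rintro ⟨u, hu, rfl⟩
    rw [rep_classPoint_mem_iff, rep_classPoint_mem_iff]
    exact add_mem_left_not_mem_right hx hx' hu

lemma IsSwitchingPair.ncard_eq (h : IsSwitchingPair Q ε m L₁ L₂) {x : V} (hx : x ∈ L₁)
    (hx' : x ∉ L₂) (hxε : quadraticChar F (Q x) = (ε : ℤ)) (P : ClassPoint Q ε → Prop) :
    {y | y ∈ pointDiff Q ε L₁ L₂ ∧ P y}.ncard = Nat.card {u : ↥(L₁ ⊓ L₂) //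
      P (classPoint Q (x + u) (h.class_add h2 hx hxε u.2))} := by
  rw [← Nat.card_coe_set_eq]
  symm
  refine Nat.card_eq_of_bijective (fun u => ⟨classPoint Q (x + u.1) (h.class_add h2 hx hxε u.1.2),
    (h.mem_pointDiff_iff_exists h2 hx hx' hxε).2 ⟨u.1, u.1.2, rfl⟩, u.2⟩) ⟨?_, ?_⟩
  · rintro ⟨⟨u, hu⟩, hP⟩ ⟨⟨v, hv⟩, hP'⟩ he
    have he' := congrArg Subtype.val he
    simp only [classPoint_eq_iff] at he'
    obtain ⟨a, ha⟩ := he'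
    have e : (a - 1) • x = u - a • v := by
      rw [sub_smul, one_smul]
      rw [smul_add] at ha
      rw [eq_sub_iff_add_eq, sub_add_eq_add_sub, ha]
      simp
    have ha1 : a = 1 := by
      by_contra hne
      apply hx'
      rw [← Submodule.smul_mem_iff L₂ (sub_ne_zero.2 hne), e]
      exact L₂.sub_mem hu.2 (L₂.smul_mem _ hv.2)
    subst ha1
    simp only [sub_self, zero_smul, one_smul] at e
    have := sub_eq_zero.1 e.symm
    subst this
    rfl
  · rintro ⟨y, hy, hP⟩
    obtain ⟨u, hu, rfl⟩ := (h.mem_pointDiff_iff_exists h2 hx hx' hxε).1 hy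
    exact ⟨⟨⟨u, hu⟩, hP⟩, rfl⟩

lemma IsSwitchingPair.ncard_pointDiff (h : IsSwitchingPair Q ε m L₁ L₂) :
    (pointDiff Q ε L₁ L₂).ncard = Nat.card ↥(L₁ ⊓ L₂) := by
  obtain ⟨x, hx, hx', hxε⟩ := h.exists_mem
  have := h.ncard_eq h2 hx hx' hxε (fun _ => True)
  simp only [and_true, Set.ofPred_mem_eq] at this
  rw [this]
  exact Nat.card_congr (Equiv.subtypeUnivEquiv fun _ => trivial)

lemma IsSwitchingPair.pointDiff_nonempty (h : IsSwitchingPair Q ε m L₁ L₂) :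
    (pointDiff Q ε L₁ L₂).Nonempty := by
  have : 0 < (pointDiff Q ε L₁ L₂).ncard := by
    rw [h.ncard_pointDiff h2]; exact Nat.card_pos
  exact (Set.ncard_pos).1 this

lemma IsSwitchingPair.nbrIn_eq_ite (h : IsSwitchingPair Q ε m L₁ L₂) {x : V} (hx : x ∈ L₁)
    (hx' : x ∉ L₂) (hxε : quadraticChar F (Q x) = (ε : ℤ)) {y : ClassPoint Q ε}
    (hy : ∀ u ∈ L₁ ⊓ L₂, polar Q y.1.rep u = 0) :
    nbrIn (orthGraph Q ε) y (pointDiff Q ε L₁ L₂) =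
      if polar Q y.1.rep x = 0 then pointDiff Q ε L₁ L₂ else ∅ := by
  have key : ∀ z ∈ pointDiff Q ε L₁ L₂, (orthGraph Q ε).Adj y z ↔ polar Q y.1.rep x = 0 := by
    intro z hz
    obtain ⟨u, hu, rfl⟩ := (h.mem_pointDiff_iff_exists h2 hx hx' hxε).1 hz
    rw [adj_classPoint_right h2, polar_add_right, hy u hu, add_zero]
  ext z
  simp only [nbrIn, Set.mem_inter_iff, SimpleGraph.mem_neighborSet]
  split_ifs with h0
  · exact ⟨fun hz => hz.2, fun hz => ⟨(key z hz).2 h0, hz⟩⟩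
  · exact ⟨fun hz => absurd ((key z hz.2).1 hz.1) h0, fun hz => absurd hz (Set.notMem_empty z)⟩

lemma IsSwitchingPair.card_mul_ncard_nbrIn (h : IsSwitchingPair Q ε m L₁ L₂) {y : ClassPoint Q ε}
    (hy : ∃ u ∈ L₁ ⊓ L₂, polar Q y.1.rep u ≠ 0) :
    Fintype.card F * (nbrIn (orthGraph Q ε) y (pointDiff Q ε L₁ L₂)).ncard =
      Nat.card ↥(L₁ ⊓ L₂) := by
  obtain ⟨x, hx, hx', hxε⟩ := h.exists_mem
  have hne : (Q.polarBilin y.1.rep).domRestrict (L₁ ⊓ L₂) ≠ 0 := by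
    obtain ⟨u, hu, hne⟩ := hy
    exact fun h0 => hne (congrArg (fun f : ↥(L₁ ⊓ L₂) →ₗ[F] F => f ⟨u, hu⟩) h0)
  rw [← card_mul_card_fiber_functional _ hne (-polar Q y.1.rep x)]
  have := h.ncard_eq h2 hx hx' hxε (fun z => (orthGraph Q ε).Adj y z)
  rw [show nbrIn (orthGraph Q ε) y (pointDiff Q ε L₁ L₂) =
    {z | z ∈ pointDiff Q ε L₁ L₂ ∧ (orthGraph Q ε).Adj y z} from Set.inter_comm _ _, this]
  congr 1
  refine Nat.card_congr (Equiv.subtypeEquivRight fun u => ?_)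
  rw [adj_classPoint_right h2, polar_add_right, add_comm, ← eq_neg_iff_add_eq_zero]
  rfl

/-- Inside `C₁ ∪ C₂`, a vertex of `C₁` has no neighbour in `C₁`, and its neighbours in `C₂` are
all of `C₂` or none. -/
lemma IsSwitchingPair.nbrIn_of_mem (h : IsSwitchingPair Q ε m L₁ L₂) {x₁ x₂ : V} (hx₁ : x₁ ∈ L₁)
    (hx₁' : x₁ ∉ L₂) (hx₁ε : quadraticChar F (Q x₁) = (ε : ℤ)) (hx₂ : x₂ ∈ L₂)
    (hx₂' : x₂ ∉ L₁) (hx₂ε : quadraticChar F (Q x₂) = (ε : ℤ)) {y : ClassPoint Q ε}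
    (hy : y ∈ pointDiff Q ε L₁ L₂) :
    nbrIn (orthGraph Q ε) y (pointDiff Q ε L₁ L₂) = ∅ ∧
      nbrIn (orthGraph Q ε) y (pointDiff Q ε L₂ L₁) =
        if polar Q x₁ x₂ = 0 then pointDiff Q ε L₂ L₁ else ∅ := by
  have hyL : y.1.rep ∈ L₁ := (mem_pointDiff_iff.1 hy).1
  have hyp : ∀ u ∈ L₁ ⊓ L₂, polar Q y.1.rep u = 0 := fun u hu => h.polar_eq_zero hu hyL
  obtain ⟨u, hu, rfl⟩ := (h.mem_pointDiff_iff_exists h2 hx₁ hx₁' hx₁ε).1 hy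
  refine ⟨?_, ?_⟩
  · rw [h.nbrIn_eq_ite h2 hx₁ hx₁' hx₁ε hyp, if_neg]
    rw [polar_rep_classPoint_eq_zero_iff, polar_add_left, polar_comm _ u, h.polar_eq_zero hu hx₁,
      add_zero, polar_self_eq]
    exact mul_ne_zero h2 (map_ne_zero_of_class hx₁ε)
  · rw [h.symm.nbrIn_eq_ite h2 hx₂ hx₂' hx₂ε (fun u hu => hyp u (by rwa [inf_comm]))]
    refine if_congr ?_ rfl rfl
    rw [polar_rep_classPoint_eq_zero_iff, polar_add_left, polar_comm _ u,
      h.polar_eq_zero' hu hx₂, add_zero]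

theorem IsSwitchingPair.isSwitchingSet [Finite (ClassPoint Q ε)]
    (h : IsSwitchingPair Q ε m L₁ L₂) :
    IsSwitchingSet (orthGraph Q ε) (pointDiff Q ε L₁ L₂) (pointDiff Q ε L₂ L₁) := by
  obtain ⟨x₁, hx₁, hx₁', hx₁ε⟩ := h.exists_mem
  obtain ⟨x₂, hx₂, hx₂', hx₂ε⟩ := h.symm.exists_mem
  have hcard : (pointDiff Q ε L₁ L₂).ncard = (pointDiff Q ε L₂ L₁).ncard := by
    rw [h.ncard_pointDiff h2, h.symm.ncard_pointDiff h2, inf_comm]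
  have hin₁ := fun y hy => h.nbrIn_of_mem h2 hx₁ hx₁' hx₁ε hx₂ hx₂' hx₂ε (y := y) hy
  have hin₂ := fun y hy => h.symm.nbrIn_of_mem h2 hx₂ hx₂' hx₂ε hx₁ hx₁' hx₁ε (y := y) hy
  have hunion : ∀ y, nbrIn (orthGraph Q ε) y (pointDiff Q ε L₁ L₂ ∪ pointDiff Q ε L₂ L₁) =
      nbrIn (orthGraph Q ε) y (pointDiff Q ε L₁ L₂) ∪
        nbrIn (orthGraph Q ε) y (pointDiff Q ε L₂ L₁) := fun y => Set.inter_union_distrib_left _ _ _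
  refine ⟨?_, hcard, ⟨0, fun y hy => ?_, fun y hy => ?_⟩,
    ⟨if polar Q x₁ x₂ = 0 then (pointDiff Q ε L₁ L₂).ncard else 0, ?_⟩, fun y _ => ?_⟩
  · exact Set.disjoint_left.2 fun y hy hy' =>
      (mem_pointDiff_iff.1 hy).2 (mem_pointDiff_iff.1 hy').1
  · rw [(hin₁ y hy).1, Set.ncard_empty]
  · rw [(hin₂ y hy).1, Set.ncard_empty]
  · rintro y (hy | hy)
    · rw [hunion, (hin₁ y hy).1, (hin₁ y hy).2, Set.empty_union]
      split_ifs
      · exact hcard.symm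
      · exact Set.ncard_empty _
    · rw [hunion, (hin₂ y hy).1, (hin₂ y hy).2, Set.union_empty, polar_comm]
      split_ifs
      · rfl
      · exact Set.ncard_empty _
  · by_cases hy : ∀ u ∈ L₁ ⊓ L₂, polar Q y.1.rep u = 0
    · rw [hunion, h.nbrIn_eq_ite h2 hx₁ hx₁' hx₁ε hy,
        h.symm.nbrIn_eq_ite h2 hx₂ hx₂' hx₂ε (fun u hu => hy u (by rwa [inf_comm]))]
      split_ifs
      · exact Or.inl hcard
      · right; left; rw [Set.union_empty]
      · right; right; rw [Set.empty_union]
      · exact Or.inl rfl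
    · push Not at hy
      left
      have h1 := h.card_mul_ncard_nbrIn h2 hy
      have h3 := h.symm.card_mul_ncard_nbrIn h2 (y := y) (by rwa [inf_comm])
      rw [inf_comm, ← h1] at h3
      exact (Nat.eq_of_mul_eq_mul_left Fintype.card_pos h3).symm

end SwitchingPairs

/-! ### Parameters of `Γ_ε` -/

section Parameters

variable {F : Type*} [Field F] [Fintype F] [DecidableEq F]
  {V : Type*} [AddCommGroup V] [Module F V] [Finite V] {Q : QuadraticForm F V} {ε δ : ℤˣ}

omit [Fintype F] [DecidableEq F] [Finite V] in
lemma inf_perp_inf_perp_sub_smul (Q : QuadraticForm F V) (W : Submodule F V) (x y : V) (a : F) :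
    W ⊓ perp Q (F ∙ x) ⊓ perp Q (F ∙ (y - a • x)) = W ⊓ perp Q (F ∙ x) ⊓ perp Q (F ∙ y) := by
  ext v
  simp only [Submodule.mem_inf, mem_perp_span_singleton]
  refine and_congr_right fun hv => ?_
  rw [polar_sub_left, polar_smul_left, hv.2, smul_zero, sub_zero]

lemma exists_pow_mul_pow_add_sign {q : ℕ} (hq : Odd q) (i j : ℕ) (s : ℤˣ) :
    ∃ v : ℕ, 2 * (v : ℤ) = (q : ℤ) ^ i * ((q : ℤ) ^ j + s) := by
  have hodd : Odd ((q : ℤ) ^ j) := by exact_mod_cast hq.pow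
  have hpos : 1 ≤ (q : ℤ) ^ j := by exact_mod_cast Nat.one_le_pow _ _ hq.pos
  obtain ⟨a, ha⟩ := hodd
  rcases Int.units_eq_one_or s with rfl | rfl
  · refine ⟨q ^ i * (a + 1).toNat, ?_⟩
    push_cast
    rw [Int.toNat_of_nonneg (by omega), ha]
    ring
  · refine ⟨q ^ i * a.toNat, ?_⟩
    push_cast
    rw [Int.toNat_of_nonneg (by omega), ha]
    ring


omit [DecidableEq F] in
/-- Vectors orthogonal to a nonzero singular vector `r` of the nondegenerate subspace `W`. -/
lemma levelCount_inf_perp_singular {W : Submodule F V} (hW : NondegOn Q W) {r : V} (hrW : r ∈ W)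
    (hr0 : r ≠ 0) (hr : Q r = 0) {n : ℕ} (hn : finrank F W = n + 1) (c : F) :
    (Fintype.card F : ℤ) * levelCount Q (W ⊓ perp Q (F ∙ r)) c =
      Fintype.card F * levelCount Q W c + (Fintype.card F : ℤ) ^ n -
        (Fintype.card F : ℤ) ^ (n + 1) := by
  have hsing : ∀ u ∈ F ∙ r, Q u = 0 := by
    intro u hu
    obtain ⟨a, rfl⟩ := Submodule.mem_span_singleton.1 hu
    rw [QuadraticMap.map_smul, hr, smul_zero]
  have key := card_mul_levelCount_of_singular Q
    ((Submodule.span_singleton_le_iff_mem r W).2 hrW) hsing c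
  obtain ⟨w, hw, hrw⟩ : ∃ w ∈ W, polar Q r w ≠ 0 := by
    by_contra! hc
    exact hr0 (hW r hrW hc)
  have hfin := finrank_inf_perp_span hw hrw
  rw [Module.natCard_eq_pow_finrank (K := F) (V := W),
    Module.natCard_eq_pow_finrank (K := F) (V := ↥(W ⊓ perp Q (F ∙ r))), hn,
    show finrank F ↥(W ⊓ perp Q (F ∙ r)) = n by omega, Nat.card_eq_fintype_card] at key
  zify at key
  linear_combination -key

omit [Fintype F] [DecidableEq F] [Finite V] in
/-- The component `z` of `y` orthogonal to `x`: its value is the Gram determinant of `x` and `y` up to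
the factor `4 Q x`, and it may replace `y` in `⟨x, y⟩^⊥`. -/
lemma exists_orthogonal_component (h2 : (2 : F) ≠ 0) {x y : V} (hx : Q x ≠ 0)
    (hxy : ∀ a : F, a • x ≠ y) :
    ∃ z ∈ (⊤ ⊓ perp Q (F ∙ x) : Submodule F V), z ≠ 0 ∧
      4 * Q x * Q z = 4 * Q x * Q y - polar Q x y ^ 2 ∧
      ⊤ ⊓ perp Q (F ∙ x) ⊓ perp Q (F ∙ z) = ⊤ ⊓ perp Q (F ∙ x) ⊓ perp Q (F ∙ y) := by
  have hz := sub_proj_mem_perp h2 hx y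
  set a := polar Q x y / (2 * Q x) with ha
  refine ⟨y - a • x, ⟨trivial, mem_perp_span_singleton.2 hz⟩, fun h0 => hxy a ?_, ?_,
    inf_perp_inf_perp_sub_smul Q ⊤ x y a⟩
  · rw [sub_eq_zero.1 h0]
  · have h := polar_smul_self_add Q a x (y - a • x)
    rw [hz, add_sub_cancel] at h
    rw [h, ha]
    field_simp
    ring

omit [Finite V] in
lemma exists_mul_eq_sq {x y : V} (hx : quadraticChar F (Q x) = (ε : ℤ))
    (hy : quadraticChar F (Q y) = (ε : ℤ)) : ∃ g : F, g ≠ 0 ∧ Q x * Q y = g ^ 2 := by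
  have h := quadraticChar_div_eq_one hx hy
  have hy0 := map_ne_zero_of_class hy
  have hx0 := map_ne_zero_of_class hx
  obtain ⟨s, hs⟩ := (quadraticChar_one_iff_isSquare (div_ne_zero hx0 hy0)).1 h
  refine ⟨s * Q y, ?_, ?_⟩
  · refine mul_ne_zero (fun h0 => ?_) hy0
    rw [h0, mul_zero] at hs
    exact div_ne_zero hx0 hy0 hs
  · rw [mul_pow, _root_.sq s, ← hs]
    field_simp

variable (h2 : (2 : F) ≠ 0)
include h2

/-- In odd dimension, the parameters of `Γ_ε` are as displayed whenever two nonorthogonal vertices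
span a degenerate plane or a plane in which the orthogonal complement of a vertex is not a
vertex. -/
lemma stronglyRegular_of_hasOddCount {d : ℕ} {s : ℤˣ} (hQ : FormNondegenerate Q)
    (hs : HasOddCount Q ⊤ (d + 1) s) (hδ : quadraticChar F (-1) = (δ : ℤ))
    (hplane : ∀ x y : V, quadraticChar F (Q x) = (ε : ℤ) → quadraticChar F (Q y) = (ε : ℤ) →
      polar Q x y ≠ 0 → 4 * Q x * Q y - polar Q x y ^ 2 = 0 ∨
        quadraticChar F (4 * Q x * Q y - polar Q x y ^ 2) = ((-δ : ℤˣ) : ℤ))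
    {v k l mu : ℕ}
    (hv : 2 * (v : ℤ) = (Fintype.card F : ℤ) ^ (d + 1) *
      ((Fintype.card F : ℤ) ^ (d + 1) + (s * ε : ℤˣ)))
    (hk : 2 * (k : ℤ) = (Fintype.card F : ℤ) ^ d *
      ((Fintype.card F : ℤ) ^ (d + 1) - (s * ε : ℤˣ)))
    (hl : 2 * (l : ℤ) = (Fintype.card F : ℤ) ^ d *
      ((Fintype.card F : ℤ) ^ d + (s * ε * δ : ℤˣ)))
    (hmu : 2 * (mu : ℤ) = (Fintype.card F : ℤ) ^ d *
      ((Fintype.card F : ℤ) ^ d - (s * ε : ℤˣ))) :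
    StronglyRegular (orthGraph Q ε) v k l mu := by
  obtain ⟨c, hc⟩ := exists_quadraticChar_eq h2 ε
  have hc0 : c ≠ 0 := ne_zero_of_quadraticChar_eq hc
  have hq : (Fintype.card F : ℤ) ≠ 0 := by exact_mod_cast Fintype.card_ne_zero
  have hW : NondegOn Q ⊤ := nondegOn_top_iff.2 hQ
  have hεε : (ε : ℤ) * ε = 1 := by
    rcases Int.units_eq_one_or ε with h | h <;> simp [h]
  have hδδ : (δ : ℤ) * δ = 1 := by
    rcases Int.units_eq_one_or δ with h | h <;> simp [h]
  have hperp : ∀ x, quadraticChar F (Q x) = (ε : ℤ) →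
      NondegOn Q (⊤ ⊓ perp Q (F ∙ x)) ∧ HasEvenCount Q (⊤ ⊓ perp Q (F ∙ x)) (d + 1) (s * ε) :=
    fun x hx => ⟨hW.inf_perp h2 trivial (map_ne_zero_of_class hx), hs.inf_perp h2 hW trivial hx⟩
  refine stronglyRegular_orthGraph h2 hc ?_ (fun x hx => ?_) (fun x y hx hy hxy => ?_)
    (fun x y hx hy hxy hind => ?_)
  · zify
    rw [hs.count, hv, hc]
    push_cast
    ring
  · zify
    apply mul_left_cancel₀ hq
    rw [(hperp x hx).2.count, hk, if_neg hc0]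
    push_cast
    ring
  · zify
    rw [((hperp x hx).2.inf_perp h2 (hperp x hx).1 hδ
      ⟨trivial, mem_perp_span_singleton.2 hxy⟩ hy).count, hl, hc]
    push_cast
    linear_combination (s * δ * ε * (Fintype.card F : ℤ) ^ d) * hεε
  · obtain ⟨z, hzW, hz0, hz, hperpz⟩ :=
      exists_orthogonal_component h2 (map_ne_zero_of_class hx) hind
    have hx0 := map_ne_zero_of_class hx
    have h4 : (4 : F) = 2 ^ 2 := by norm_num
    have h40 : (4 : F) ≠ 0 := by rw [h4]; exact pow_ne_zero 2 h2
    rw [← hperpz]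
    zify
    rcases hplane x y hx hy hxy with hD | hD
    · have hz' : Q z = 0 := by
        rw [hD] at hz
        exact (mul_eq_zero.1 hz).resolve_left (mul_ne_zero h40 hx0)
      apply mul_left_cancel₀ hq
      have hfin : finrank F ↥(⊤ ⊓ perp Q (F ∙ x)) = (2 * d + 1) + 1 := by
        rw [(hperp x hx).2.finrank_eq]; ring
      rw [levelCount_inf_perp_singular (hperp x hx).1 hzW hz0 hz' hfin,
        (hperp x hx).2.count, hmu, if_neg hc0]
      push_cast
      ring
    · have hz' : quadraticChar F (Q z) = ((-(δ * ε) : ℤˣ) : ℤ) := by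
        rw [← hz, map_mul, map_mul, h4, quadraticChar_sq_one' h2, one_mul, hx] at hD
        apply mul_left_cancel₀ ε.ne_zero
        rw [hD]
        push_cast
        linear_combination (δ : ℤ) * hεε
      rw [((hperp x hx).2.inf_perp h2 (hperp x hx).1 hδ hzW hz').count, hmu, hc]
      push_cast
      linear_combination (-s * ε * (Fintype.card F : ℤ) ^ d) * hδδ * (ε : ℤ) ^ 2 -
        (s * ε * (Fintype.card F : ℤ) ^ d) * hεε

/-- In even dimension, the parameters of `Γ_ε` are as displayed whenever two nonorthogonal vertices
span a degenerate plane. -/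
lemma stronglyRegular_of_hasEvenCount {d : ℕ} {s : ℤˣ} (hQ : FormNondegenerate Q)
    (hs : HasEvenCount Q ⊤ (d + 2) s) (hδ : quadraticChar F (-1) = (δ : ℤ))
    (hplane : ∀ x y : V, quadraticChar F (Q x) = (ε : ℤ) → quadraticChar F (Q y) = (ε : ℤ) →
      polar Q x y ≠ 0 → 4 * Q x * Q y - polar Q x y ^ 2 = 0)
    {v k l mu : ℕ}
    (hv : 2 * (v : ℤ) = (Fintype.card F : ℤ) ^ (d + 1) *
      ((Fintype.card F : ℤ) ^ (d + 2) - s))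
    (hk : 2 * (k : ℤ) = (Fintype.card F : ℤ) ^ (d + 1) *
      ((Fintype.card F : ℤ) ^ (d + 1) + (s * δ : ℤˣ)))
    (hl : 2 * (l : ℤ) = (Fintype.card F : ℤ) ^ d *
      ((Fintype.card F : ℤ) ^ (d + 1) - (s * δ : ℤˣ)))
    (hmu : 2 * (mu : ℤ) = (Fintype.card F : ℤ) ^ (d + 1) *
      ((Fintype.card F : ℤ) ^ d + (s * δ : ℤˣ))) :
    StronglyRegular (orthGraph Q ε) v k l mu := by
  obtain ⟨c, hc⟩ := exists_quadraticChar_eq h2 ε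
  have hc0 : c ≠ 0 := ne_zero_of_quadraticChar_eq hc
  have hq : (Fintype.card F : ℤ) ≠ 0 := by exact_mod_cast Fintype.card_ne_zero
  have hW : NondegOn Q ⊤ := nondegOn_top_iff.2 hQ
  have hεε : (ε : ℤ) * ε = 1 := by
    rcases Int.units_eq_one_or ε with h | h <;> simp [h]
  have hperp : ∀ x, quadraticChar F (Q x) = (ε : ℤ) →
      NondegOn Q (⊤ ⊓ perp Q (F ∙ x)) ∧
        HasOddCount Q (⊤ ⊓ perp Q (F ∙ x)) (d + 1) (s * ε * δ) :=
    fun x hx => ⟨hW.inf_perp h2 trivial (map_ne_zero_of_class hx),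
      hs.inf_perp h2 hW hδ trivial hx⟩
  refine stronglyRegular_orthGraph h2 hc ?_ (fun x hx => ?_) (fun x y hx hy hxy => ?_)
    (fun x y hx hy hxy hind => ?_)
  · zify
    apply mul_left_cancel₀ hq
    rw [hs.count, hv, if_neg hc0]
    ring
  · zify
    rw [(hperp x hx).2.count, hk, hc]
    push_cast
    linear_combination (s * δ * (Fintype.card F : ℤ) ^ (d + 1)) * hεε
  · zify
    apply mul_left_cancel₀ hq
    rw [((hperp x hx).2.inf_perp h2 (hperp x hx).1
      ⟨trivial, mem_perp_span_singleton.2 hxy⟩ hy).count, hl, if_neg hc0]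
    push_cast
    linear_combination (-s * δ * (Fintype.card F : ℤ) ^ (d + 1)) * hεε
  · obtain ⟨z, hzW, hz0, hz, hperpz⟩ :=
      exists_orthogonal_component h2 (map_ne_zero_of_class hx) hind
    have hx0 := map_ne_zero_of_class hx
    have h40 : (4 : F) ≠ 0 := by
      rw [show (4 : F) = 2 ^ 2 by norm_num]; exact pow_ne_zero 2 h2
    rw [← hperpz]
    zify
    have hz' : Q z = 0 := by
      rw [hplane x y hx hy hxy] at hz
      exact (mul_eq_zero.1 hz).resolve_left (mul_ne_zero h40 hx0)
    apply mul_left_cancel₀ hq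
    have hfin : finrank F ↥(⊤ ⊓ perp Q (F ∙ x)) = (2 * d + 2) + 1 := by
      rw [(hperp x hx).2.finrank_eq]; ring
    rw [levelCount_inf_perp_singular (hperp x hx).1 hzW hz0 hz' hfin,
      (hperp x hx).2.count, hmu, hc]
    push_cast
    linear_combination (s * δ * (Fintype.card F : ℤ) ^ (d + 2)) * hεε

omit [Finite V] h2 in
/-- Over `𝔽₃`, two nonorthogonal vectors of the same class span a degenerate plane. -/
lemma degenerate_plane_of_card_three (h3 : Fintype.card F = 3) {x y : V}
    (hx : quadraticChar F (Q x) = (ε : ℤ)) (hy : quadraticChar F (Q y) = (ε : ℤ))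
    (hxy : polar Q x y ≠ 0) : 4 * Q x * Q y - polar Q x y ^ 2 = 0 := by
  obtain ⟨g, hg, hgxy⟩ := exists_mul_eq_sq hx hy
  have hsq : ∀ a : F, a ≠ 0 → a ^ 2 = 1 := fun a ha => by
    have := FiniteField.pow_card_sub_one_eq_one a ha
    rwa [h3] at this
  have h30 : (3 : F) = 0 := by
    have := FiniteField.cast_card_eq_zero F
    rw [h3] at this
    exact_mod_cast this
  rw [mul_assoc, hgxy, hsq g hg, hsq _ hxy]
  linear_combination h30

omit [Finite V] in
/-- Over `𝔽₅`, two nonorthogonal vectors of the same class span a degenerate plane, or a plane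
whose Gram determinant is not a square. -/
lemma plane_of_card_five (h5 : Fintype.card F = 5) {x y : V}
    (hx : quadraticChar F (Q x) = (ε : ℤ)) (hy : quadraticChar F (Q y) = (ε : ℤ))
    (hxy : polar Q x y ≠ 0) : 4 * Q x * Q y - polar Q x y ^ 2 = 0 ∨
      quadraticChar F (4 * Q x * Q y - polar Q x y ^ 2) = -1 := by
  obtain ⟨g, hg, hgxy⟩ := exists_mul_eq_sq hx hy
  have hchar := ringChar_ne_two_of_two_ne_zero h2
  have h50 : (5 : F) = 0 := by
    have := FiniteField.cast_card_eq_zero F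
    rw [h5] at this
    exact_mod_cast this
  set t := polar Q x y / g with ht
  have ht0 : t ≠ 0 := div_ne_zero hxy hg
  have hfour : t ^ 4 = 1 := by
    have := FiniteField.pow_card_sub_one_eq_one t ht0
    rwa [h5] at this
  have hD : 4 * Q x * Q y - polar Q x y ^ 2 = g ^ 2 * (4 - t ^ 2) := by
    rw [mul_assoc, hgxy, ht]
    field_simp
  have : (t ^ 2 - 1) * (t ^ 2 + 1) = 0 := by linear_combination hfour
  rcases mul_eq_zero.1 this with h | h
  · right
    rw [hD, map_mul, quadraticChar_sq_one' hg, one_mul,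
      show (4 : F) - t ^ 2 = -2 by linear_combination h50 - h, quadraticChar_neg_two hchar, h5]
    decide
  · left
    rw [hD, show (4 : F) - t ^ 2 = 0 by linear_combination h50 - h, mul_zero]

end Parameters

/-! ### Nonisomorphism of the switched graph -/

section Vectors

variable {F : Type*} [Field F] {V : Type*} [AddCommGroup V] [Module F V]
  {Q : QuadraticForm F V}

section

variable [FiniteDimensional F V]

lemma exists_perp_polar_ne_zero (hQ : FormNondegenerate Q) {S : Submodule F V} {v : V}
    (hv : v ∉ S) : ∃ z, (∀ s ∈ S, polar Q z s = 0) ∧ polar Q z v ≠ 0 := by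
  by_contra! hc
  apply hv
  rw [← LinearMap.BilinForm.orthogonal_orthogonal hQ (isRefl_polarBilin Q) S]
  refine mem_perp_iff.2 fun z hz => hc z fun s hs => ?_
  rw [polar_comm]
  exact mem_perp_iff.1 hz s hs

lemma exists_perp_polar_ne_zero₂ (hQ : FormNondegenerate Q) {S : Submodule F V} {v w : V}
    (hv : v ∉ S) (hw : w ∉ S) :
    ∃ z, (∀ s ∈ S, polar Q z s = 0) ∧ polar Q z v ≠ 0 ∧ polar Q z w ≠ 0 := by
  obtain ⟨z, hz, hzv⟩ := exists_perp_polar_ne_zero hQ hv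
  obtain ⟨z', hz', hzw⟩ := exists_perp_polar_ne_zero hQ hw
  by_cases h1 : polar Q z w = 0
  · by_cases h3 : polar Q z' v = 0
    · refine ⟨z + z', fun s hs => ?_, ?_, ?_⟩
      · rw [polar_add_left, hz s hs, hz' s hs, add_zero]
      · rwa [polar_add_left, h3, add_zero]
      · rwa [polar_add_left, h1, zero_add]
    · exact ⟨z', hz', h3, hzw⟩
  · exact ⟨z, hz, hzv, h1⟩

end

variable [Fintype F] [Finite V] (h2 : (2 : F) ≠ 0)
include h2

lemma exists_map_eq_of_two_le_finrank {W : Submodule F V} (hW : NondegOn Q W)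
    (hn : 2 ≤ finrank F W) {b : F} (hb : b ≠ 0) : ∃ v ∈ W, Q v = b := by
  classical
  apply exists_of_levelCount_pos
  zify
  have hq : (1 : ℤ) < Fintype.card F := by exact_mod_cast Fintype.one_lt_card
  obtain ⟨h1, h3⟩ := exists_count_of_nondegOn h2 _ hW rfl
  rcases Nat.even_or_odd' (finrank F W) with ⟨k, hk | hk⟩
  · obtain ⟨s, hs⟩ := h1 k hk
    have hlt : (Fintype.card F : ℤ) ^ k < (Fintype.card F : ℤ) ^ (2 * k) :=
      pow_lt_pow_right₀ hq (by omega)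
    have hc := hs.count b
    rw [if_neg hb] at hc
    have : 0 < (Fintype.card F : ℤ) * levelCount Q W b := by
      rw [hc]
      have hpos : 0 < (Fintype.card F : ℤ) ^ k := by positivity
      rcases Int.units_eq_one_or s with rfl | rfl
      · push_cast; linarith
      · push_cast; linarith
    exact pos_of_mul_pos_right this (by positivity)
  · obtain ⟨s, hs⟩ := h3 k hk
    have hlt : (Fintype.card F : ℤ) ^ k < (Fintype.card F : ℤ) ^ (2 * k) :=
      pow_lt_pow_right₀ hq (by omega)
    obtain ⟨η, hη⟩ := exists_sign_quadraticChar hb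
    rw [hs.count b, hη]
    have hpos : 0 < (Fintype.card F : ℤ) ^ k := by positivity
    rcases Int.units_eq_one_or s with rfl | rfl <;> rcases Int.units_eq_one_or η with rfl | rfl <;>
      push_cast <;> linarith

/-- In dimension at least three, every value is taken outside any given hyperplane `u^⊥`. -/
lemma exists_map_eq_polar_ne_zero {W : Submodule F V} (hW : NondegOn Q W)
    (hn : 3 ≤ finrank F W) {u : V} (hu : u ∈ W) (hu0 : u ≠ 0) (a : F) :
    ∃ v ∈ W, Q v = a ∧ polar Q v u ≠ 0 := by
  by_cases hQu : Q u = 0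
  · obtain ⟨w, hw, hne⟩ : ∃ w ∈ W, polar Q u w ≠ 0 := by
      by_contra! hc
      exact hu0 (hW u hu hc)
    refine ⟨((a - Q w) / polar Q u w) • u + w, W.add_mem (W.smul_mem _ hu) hw, ?_, ?_⟩
    · rw [polar_smul_self_add, hQu]
      field_simp
      ring
    · rwa [polar_add_left, polar_smul_left, polar_self_eq, hQu, mul_zero, smul_zero, zero_add,
        polar_comm]
  · by_cases ha : a = Q u
    · exact ⟨u, hu, ha.symm, by rw [polar_self_eq]; exact mul_ne_zero h2 hQu⟩
    · have hfin := finrank_inf_perp_of_map_ne_zero h2 hu hQu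
      obtain ⟨v, hv, hQv⟩ := exists_map_eq_of_two_le_finrank h2 (hW.inf_perp h2 hu hQu)
        (by omega) (sub_ne_zero.2 ha)
      have hv' := mem_perp_span_singleton.1 hv.2
      refine ⟨u + v, W.add_mem hu hv.1, ?_, ?_⟩
      · rw [QuadraticMap.map_add Q, hQv, hv']; ring
      · rw [polar_add_left, polar_comm Q v, hv', add_zero, polar_self_eq]
        exact mul_ne_zero h2 hQu

/-- Given a nondegenerate subspace `K` with `dim K^⊥ ≥ 3`, the component of `z` in `K^⊥` can be
changed so as to prescribe the value of `Q` and to avoid orthogonality to a vector outside `K`. -/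
lemma exists_same_polar_on (hQ : FormNondegenerate Q) {K : Submodule F V} (hK : NondegOn Q K)
    (hn : finrank F K + 3 ≤ finrank F V) {u : V} (hu : u ∉ K) (z : V) (c : F) :
    ∃ z', (∀ k ∈ K, polar Q z' k = polar Q z k) ∧ Q z' = c ∧ polar Q z' u ≠ 0 ∧ z' ∉ K := by
  have hcompl : IsCompl K (perp Q K) :=
    LinearMap.BilinForm.isCompl_orthogonal_of_restrict_nondegenerate (isRefl_polarBilin Q)
      (formNondegenerate_restrict_iff.2 hK)
  have hdec : ∀ v : V, ∃ a ∈ K, ∃ b ∈ perp Q K, a + b = v := fun v => by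
    have : v ∈ K ⊔ perp Q K := by rw [hcompl.sup_eq_top]; trivial
    exact Submodule.mem_sup.1 this
  have hKE : ∀ a ∈ K, ∀ b ∈ perp Q K, polar Q a b = 0 := fun a ha b hb => mem_perp_iff.1 hb a ha
  have hE : NondegOn Q (perp Q K) := by
    intro v hv hvE
    refine formNondegenerate_iff.1 hQ v fun w => ?_
    obtain ⟨a, ha, b, hb, rfl⟩ := hdec w
    rw [polar_add_right, hvE b hb, polar_comm, hKE a ha v hv, add_zero]
  have hEfin : finrank F (perp Q K) = finrank F V - finrank F K :=
    LinearMap.BilinForm.finrank_orthogonal hQ K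
  obtain ⟨z₀, hz₀, z₁, hz₁, rfl⟩ := hdec z
  obtain ⟨u₀, hu₀, u₁, hu₁, rfl⟩ := hdec u
  have hu1 : u₁ ≠ 0 := by rintro rfl; exact hu (by simpa using hu₀)
  obtain ⟨k, hkE, hQk, hku⟩ :=
    exists_map_eq_polar_ne_zero h2 hE (by omega) hu₁ hu1 (c - Q z₀)
  have hk0 : k ≠ 0 := by rintro rfl; simp at hku
  -- replacing `k` by `-k` changes the pairing with `u`
  obtain ⟨k', hkE', hQk', hku', hk0'⟩ : ∃ k' ∈ perp Q K, Q k' = c - Q z₀ ∧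
      polar Q (z₀ + k') (u₀ + u₁) ≠ 0 ∧ k' ≠ 0 := by
    have hpol : ∀ b ∈ perp Q K, polar Q (z₀ + b) (u₀ + u₁) = polar Q z₀ u₀ + polar Q b u₁ := by
      intro b hb
      rw [polar_add_left, polar_add_right, polar_add_right, hKE z₀ hz₀ u₁ hu₁, polar_comm Q b u₀,
        hKE u₀ hu₀ b hb]
      ring
    by_cases h0 : polar Q (z₀ + k) (u₀ + u₁) = 0
    · refine ⟨-k, Submodule.neg_mem _ hkE, by rw [QuadraticMap.map_neg, hQk], fun h1 => ?_,
        neg_ne_zero.2 hk0⟩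
      rw [hpol _ hkE] at h0
      rw [hpol _ (Submodule.neg_mem _ hkE), polar_neg_left] at h1
      have : 2 * polar Q k u₁ = 0 := by linear_combination h0 - h1
      exact hku ((mul_eq_zero.1 this).resolve_left h2)
    · exact ⟨k, hkE, hQk, h0, hk0⟩
  refine ⟨z₀ + k', fun a ha => ?_, ?_, hku', fun hmem => hk0' ?_⟩
  · rw [polar_add_left, polar_add_left, polar_comm Q k', polar_comm Q z₁, hKE a ha _ hkE',
      hKE a ha _ hz₁]
  · rw [QuadraticMap.map_add Q, hQk', hKE z₀ hz₀ k' hkE']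
    ring
  · have h1 : k' ∈ K := by simpa using K.sub_mem hmem hz₀
    exact Submodule.disjoint_def.1 hcompl.disjoint k' h1 hkE'

end Vectors

section NonIsomorphism

variable {F : Type*} [Field F] [Fintype F] [DecidableEq F]
  {V : Type*} [AddCommGroup V] [Module F V] {Q : QuadraticForm F V} {ε : ℤˣ} {m : ℕ}
  {L₁ L₂ : Submodule F V}

/-- In `Γ_ε`, the reflection of `y` in `x^⊥` is a third vertex that is adjacent to all common
neighbours of the nonadjacent vertices `x` and `y`. -/
lemma exists_third_vertex (h2 : (2 : F) ≠ 0) {x y : ClassPoint Q ε} (hne : x ≠ y)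
    (hxy : ¬ (orthGraph Q ε).Adj x y) :
    ∃ z, z ≠ x ∧ z ≠ y ∧ ∀ v, (orthGraph Q ε).Adj v x → (orthGraph Q ε).Adj v y →
      (orthGraph Q ε).Adj v z := by
  rw [orthGraph_adj_iff h2] at hxy
  have hx0 := map_ne_zero_of_class x.2
  set a := polar Q x.1.rep y.1.rep / Q x.1.rep with ha
  have ha0 : a ≠ 0 := div_ne_zero hxy hx0
  have hQ : Q (-a • x.1.rep + y.1.rep) = Q y.1.rep := by
    rw [polar_smul_self_add, ha]
    field_simp
    ring
  have hcl : quadraticChar F (Q (-a • x.1.rep + y.1.rep)) = (ε : ℤ) := by rw [hQ]; exact y.2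
  have hind : ∀ b : F, b • x.1.rep ≠ y.1.rep := fun b hb => hne <| by
    rw [← classPoint_rep x, ← classPoint_rep y, eq_comm, classPoint_eq_iff]
    exact ⟨b, hb⟩
  refine ⟨classPoint Q _ hcl, fun h => ?_, fun h => ?_, fun v hvx hvy => ?_⟩
  · obtain ⟨b, hb⟩ := (classPoint_eq_iff _ _).1 (h.trans (classPoint_rep x).symm)
    refine hind (b + a) ?_
    rw [add_smul, hb]
    simp
  · obtain ⟨b, hb⟩ := (classPoint_eq_iff _ _).1 (h.trans (classPoint_rep y).symm)
    by_cases hb1 : b = 1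
    · rw [hb1, one_smul] at hb
      have : a • x.1.rep = 0 := by simpa using hb
      rcases smul_eq_zero.1 this with h0 | h0
      · exact ha0 h0
      · exact x.1.rep_nonzero h0
    · refine hind (-a / (b - 1)) ?_
      have hb1' : b - 1 ≠ 0 := sub_ne_zero.2 hb1
      have e : -a • x.1.rep = (b - 1) • y.1.rep := by
        rw [sub_smul, one_smul, hb, add_sub_cancel_right]
      rw [div_eq_inv_mul, mul_smul, e, smul_smul, inv_mul_cancel₀ hb1', one_smul]
  · rw [orthGraph_adj_iff h2] at hvx hvy
    rw [adj_classPoint_right h2, polar_add_right, polar_smul_right, hvx, hvy, smul_zero, add_zero]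

lemma IsSwitchingPair.polar_eq_zero_of_mem_union (h : IsSwitchingPair Q ε m L₁ L₂)
    {y : ClassPoint Q ε} (hy : y ∈ pointDiff Q ε L₁ L₂ ∪ pointDiff Q ε L₂ L₁) {u : V}
    (hu : u ∈ L₁ ⊓ L₂) : polar Q y.1.rep u = 0 := by
  rcases hy with hy | hy
  · exact h.polar_eq_zero hu (mem_pointDiff_iff.1 hy).1
  · exact h.polar_eq_zero' hu (mem_pointDiff_iff.1 hy).1

lemma switchedOrthGraph_adj_of_notMem {y z : ClassPoint Q ε}
    (hy : y ∉ pointDiff Q ε L₁ L₂ ∪ pointDiff Q ε L₂ L₁)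
    (hz : z ∉ pointDiff Q ε L₁ L₂ ∪ pointDiff Q ε L₂ L₁) :
    (switchedOrthGraph Q ε L₁ L₂).Adj y z ↔ (orthGraph Q ε).Adj y z := by
  simp only [switchedOrthGraph, switchedGraph, hy, hz, false_and, and_false, or_false, true_and]

variable [Finite V] (h2 : (2 : F) ≠ 0)
include h2

/-- Switching does not change the neighbours of a vertex that is not orthogonal to `L₁ ∩ L₂`. -/
lemma IsSwitchingPair.adj_iff_of_polar_ne_zero (h : IsSwitchingPair Q ε m L₁ L₂)
    {y : ClassPoint Q ε} {u : V} (hu : u ∈ L₁ ⊓ L₂) (hy : polar Q y.1.rep u ≠ 0)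
    (z : ClassPoint Q ε) :
    (switchedOrthGraph Q ε L₁ L₂).Adj y z ↔ (orthGraph Q ε).Adj y z := by
  have hyC : y ∉ pointDiff Q ε L₁ L₂ ∪ pointDiff Q ε L₂ L₁ :=
    fun hc => hy (h.polar_eq_zero_of_mem_union hc hu)
  by_cases hz : z ∈ pointDiff Q ε L₁ L₂ ∪ pointDiff Q ε L₂ L₁
  · have h1 := h.card_mul_ncard_nbrIn h2 ⟨u, hu, hy⟩
    have h3 := h.symm.card_mul_ncard_nbrIn h2 ⟨u, by rwa [inf_comm], hy⟩
    have hpos : 0 < Nat.card ↥(L₁ ⊓ L₂) := Nat.card_pos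
    have hpos' : 0 < Nat.card ↥(L₂ ⊓ L₁) := Nat.card_pos
    have hdisj : Disjoint (pointDiff Q ε L₁ L₂) (pointDiff Q ε L₂ L₁) :=
      Set.disjoint_left.2 fun y hy hy' => (mem_pointDiff_iff.1 hy).2 (mem_pointDiff_iff.1 hy').1
    have hsw : switchedNbr (orthGraph Q ε) (pointDiff Q ε L₁ L₂) (pointDiff Q ε L₂ L₁) y =
        nbrIn (orthGraph Q ε) y (pointDiff Q ε L₁ L₂ ∪ pointDiff Q ε L₂ L₁) := by
      have hsub : ∀ S ⊆ pointDiff Q ε L₁ L₂ ∪ pointDiff Q ε L₂ L₁, nbrIn (orthGraph Q ε) y S =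
          nbrIn (orthGraph Q ε) y (pointDiff Q ε L₁ L₂ ∪ pointDiff Q ε L₂ L₁) ∩ S := by
        intro S hS
        rw [nbrIn, nbrIn, Set.inter_assoc, Set.inter_eq_right.2 hS]
      rw [switchedNbr, if_neg, if_neg]
      · intro hc
        rw [hsub _ Set.subset_union_right, hc, hdisj.inter_eq, Set.ncard_empty, mul_zero] at h3
        omega
      · intro hc
        rw [hsub _ Set.subset_union_left, hc, hdisj.symm.inter_eq, Set.ncard_empty, mul_zero] at h1
        omega
    simp only [switchedOrthGraph, switchedGraph, hyC, hz, not_true, false_and, false_or, true_and,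
      false_iff, not_false_iff, or_false, hsw, nbrIn, Set.mem_inter_iff,
      SimpleGraph.mem_neighborSet, and_true]
  · exact switchedOrthGraph_adj_of_notMem hyC hz

/-- A vertex outside `C₁ ∪ C₂` whose neighbours in `C₁ ∪ C₂` are the vertices of `C₂` becomes
adjacent to all vertices of `C₁`. -/
lemma IsSwitchingPair.adj_of_nbrIn_right (h : IsSwitchingPair Q ε m L₁ L₂) {x₁ x₂ : V}
    (hx₁ : x₁ ∈ L₁) (hx₁' : x₁ ∉ L₂) (hx₁ε : quadraticChar F (Q x₁) = (ε : ℤ)) (hx₂ : x₂ ∈ L₂)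
    (hx₂' : x₂ ∉ L₁) (hx₂ε : quadraticChar F (Q x₂) = (ε : ℤ)) {y z : ClassPoint Q ε}
    (hyC : y ∉ pointDiff Q ε L₁ L₂ ∪ pointDiff Q ε L₂ L₁)
    (hy : ∀ u ∈ L₁ ⊓ L₂, polar Q y.1.rep u = 0) (hy₁ : polar Q y.1.rep x₁ ≠ 0)
    (hy₂ : polar Q y.1.rep x₂ = 0) (hz : z ∈ pointDiff Q ε L₁ L₂) :
    (switchedOrthGraph Q ε L₁ L₂).Adj y z := by
  have hnbr : nbrIn (orthGraph Q ε) y (pointDiff Q ε L₁ L₂ ∪ pointDiff Q ε L₂ L₁) =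
      pointDiff Q ε L₂ L₁ := by
    have e : nbrIn (orthGraph Q ε) y (pointDiff Q ε L₁ L₂ ∪ pointDiff Q ε L₂ L₁) =
      nbrIn (orthGraph Q ε) y (pointDiff Q ε L₁ L₂) ∪
        nbrIn (orthGraph Q ε) y (pointDiff Q ε L₂ L₁) := Set.inter_union_distrib_left _ _ _
    rw [e, h.nbrIn_eq_ite h2 hx₁ hx₁' hx₁ε hy, if_neg hy₁,
      h.symm.nbrIn_eq_ite h2 hx₂ hx₂' hx₂ε (fun u hu => hy u (by rwa [inf_comm])), if_pos hy₂,
      Set.empty_union]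
  refine Or.inr (Or.inl ⟨hyC, Or.inl hz, ?_⟩)
  rw [switchedNbr, if_pos hnbr]
  exact hz

/-- In the switched graph there are two nonadjacent vertices without a third vertex that is
adjacent to all their common neighbours: a vertex `x₁` of `C₁` and a vertex `w` not orthogonal
to `L₁ ∩ L₂`. -/
lemma IsSwitchingPair.exists_pair_without_third (hQ : FormNondegenerate Q)
    (hn : 7 ≤ finrank F V) (h : IsSwitchingPair Q ε 3 L₁ L₂)
    (hP : ∀ v ∈ L₁ ⊔ L₂, (∀ w ∈ L₁ ⊔ L₂, polar Q v w = 0) → v ∈ L₁ ⊓ L₂) :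
    ∃ x y : ClassPoint Q ε, x ≠ y ∧ ¬ (switchedOrthGraph Q ε L₁ L₂).Adj x y ∧
      ∀ z, z ≠ x → z ≠ y → ∃ v, (switchedOrthGraph Q ε L₁ L₂).Adj v x ∧
        (switchedOrthGraph Q ε L₁ L₂).Adj v y ∧ ¬ (switchedOrthGraph Q ε L₁ L₂).Adj v z := by
  obtain ⟨x₁, hx₁, hx₁', hx₁ε⟩ := h.exists_mem
  obtain ⟨x₂, hx₂, hx₂', hx₂ε⟩ := h.symm.exists_mem
  -- the point `L₁ ∩ L₂ = ⟨r⟩`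
  obtain ⟨r, hr, hr0, hspan⟩ : ∃ r ∈ L₁ ⊓ L₂, r ≠ 0 ∧ ∀ u ∈ L₁ ⊓ L₂, ∃ a : F, u = a • r := by
    have h1 : finrank F ↥(L₁ ⊓ L₂) = 1 := by have := h.finrank_inf; omega
    obtain ⟨r, hr0, hr⟩ := finrank_eq_one_iff'.1 h1
    refine ⟨r, r.2, fun h0 => hr0 (Subtype.ext h0), fun u hu => ?_⟩
    obtain ⟨a, ha⟩ := hr ⟨u, hu⟩
    exact ⟨a, by rw [← Submodule.coe_smul, ha]⟩
  have hQr : Q r = 0 := h.map_inf_eq_zero h2 hr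
  have hpr : ∀ v ∈ L₁ ⊔ L₂, polar Q v r = 0 := by
    intro v hv
    obtain ⟨a, ha, b, hb, rfl⟩ := Submodule.mem_sup.1 hv
    rw [polar_add_left, h.polar_eq_zero hr ha, h.polar_eq_zero' hr hb, add_zero]
  have hx₁P : x₁ ∈ L₁ ⊔ L₂ := le_sup_left (a := L₁) hx₁
  have hx₂P : x₂ ∈ L₁ ⊔ L₂ := le_sup_right (a := L₁) hx₂
  have hrP : r ∈ L₁ ⊔ L₂ := le_sup_left (a := L₁) hr.1
  -- a vertex `w` that is orthogonal neither to `r` nor to `x₁`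
  obtain ⟨w, hwε, hwr, hwx⟩ : ∃ w, quadraticChar F (Q w) = (ε : ℤ) ∧ polar Q w r ≠ 0 ∧
      polar Q w x₁ ≠ 0 := by
    obtain ⟨g, -, hgr, hgx⟩ := exists_perp_polar_ne_zero₂ hQ (S := ⊥) (v := r) (w := x₁)
      (by simpa using hr0) (by simpa using ne_zero_of_class hx₁ε)
    have hQw : Q (((Q x₁ - Q g) / polar Q g r) • r + g) = Q x₁ := by
      rw [polar_smul_self_add, hQr, polar_comm Q r g]
      field_simp
      ring
    refine ⟨((Q x₁ - Q g) / polar Q g r) • r + g, by rw [hQw, hx₁ε], ?_, ?_⟩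
    · rwa [polar_add_left, polar_smul_left, polar_self_eq, hQr, mul_zero, smul_zero, zero_add]
    · rwa [polar_add_left, polar_smul_left, polar_comm Q r, h.polar_eq_zero hr hx₁, smul_zero,
        zero_add]
  set K : Submodule F V := (L₁ ⊔ L₂) ⊔ F ∙ w with hKdef
  have hPK : L₁ ⊔ L₂ ≤ K := le_sup_left
  have hwK : w ∈ K := le_sup_right (a := L₁ ⊔ L₂) (Submodule.mem_span_singleton_self w)
  have hK : NondegOn Q K := by
    intro v hv hvK
    obtain ⟨a, ha, y, hy, rfl⟩ := Submodule.mem_sup.1 hv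
    obtain ⟨b, rfl⟩ := Submodule.mem_span_singleton.1 hy
    have hb : b = 0 := by
      have := hvK r (hPK hrP)
      rw [polar_add_left, hpr a ha, zero_add, polar_smul_left] at this
      exact (smul_eq_zero.1 this).resolve_right hwr
    subst hb
    simp only [zero_smul, add_zero] at hvK ⊢
    obtain ⟨t, rfl⟩ := hspan a (hP a ha fun w hw => hvK w (hPK hw))
    have := hvK w hwK
    rw [polar_smul_left, polar_comm] at this
    rw [(smul_eq_zero.1 this).resolve_right hwr, zero_smul]
  have hKfin : finrank F K + 3 ≤ finrank F V := by
    have h1 := Submodule.finrank_sup_add_finrank_inf_eq L₁ L₂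
    have h3 := Submodule.finrank_add_le_finrank_add_finrank (L₁ ⊔ L₂) (F ∙ w)
    have h4 := finrank_span_singleton (K := F) (ne_zero_of_class hwε)
    have h5 := h.finrank_left
    have h6 := h.finrank_right
    have h7 := h.finrank_inf
    rw [← hKdef] at h3
    omega
  obtain ⟨u₀, hu₀⟩ : ∃ u₀, u₀ ∉ K := by
    by_contra! hc
    have : K = ⊤ := eq_top_iff.2 fun v _ => hc v
    rw [this, finrank_top] at hKfin
    omega
  have hC : ∀ {v : V} (hv : quadraticChar F (Q v) = (ε : ℤ)), v ∉ L₁ ⊔ L₂ →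
      classPoint Q v hv ∉ pointDiff Q ε L₁ L₂ ∪ pointDiff Q ε L₂ L₁ := by
    rintro v hv hvP (hc | hc)
    · rw [mem_pointDiff_iff, rep_classPoint_mem_iff] at hc
      exact hvP (le_sup_left (a := L₁) hc.1)
    · rw [mem_pointDiff_iff, rep_classPoint_mem_iff] at hc
      exact hvP (le_sup_right (a := L₁) hc.1)
  have hwP : w ∉ L₁ ⊔ L₂ := fun hw => hwr (hpr w hw)
  have hnotadj : ∀ {v : V} (hv : quadraticChar F (Q v) = (ε : ℤ)) (y : ClassPoint Q ε),
      polar Q v r ≠ 0 →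
      ((switchedOrthGraph Q ε L₁ L₂).Adj (classPoint Q v hv) y ↔ polar Q v y.1.rep = 0) := by
    intro v hv y hvr
    rw [h.adj_iff_of_polar_ne_zero h2 hr, adj_classPoint_left h2]
    rwa [Ne, polar_rep_classPoint_eq_zero_iff]
  have hrep : ∀ {v : V} (hv : quadraticChar F (Q v) = (ε : ℤ)) (y : V),
      polar Q y (classPoint Q v hv).1.rep = 0 ↔ polar Q y v = 0 := by
    intro v hv y
    rw [polar_comm, polar_rep_classPoint_eq_zero_iff, polar_comm]
  refine ⟨classPoint Q x₁ hx₁ε, classPoint Q w hwε, fun he => ?_, fun hadj => ?_,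
    fun z hzx hzw => ?_⟩
  · obtain ⟨a, ha⟩ := (classPoint_eq_iff hx₁ε hwε).1 he
    have := hpr x₁ hx₁P
    rw [← ha, polar_smul_left] at this
    rw [(smul_eq_zero.1 this).resolve_right hwr, zero_smul] at ha
    exact ne_zero_of_class hx₁ε ha.symm
  · rw [SimpleGraph.adj_comm, hnotadj hwε _ hwr, hrep] at hadj
    exact hwx hadj
  by_cases hu : z.1.rep ∈ Submodule.span F {x₁, w}
  · -- `z` on the line `⟨x₁, w⟩`: use a common neighbour orthogonal to `r` and `x₂`, not to `x₁`
    obtain ⟨α, β, hz⟩ := Submodule.mem_span_pair.1 hu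
    have hα : α ≠ 0 := by
      rintro rfl
      apply hzw
      rw [← classPoint_rep z, classPoint_eq_iff]
      exact ⟨β, by rw [← hz, zero_smul, zero_add]⟩
    have hβ : β ≠ 0 := by
      rintro rfl
      apply hzx
      rw [← classPoint_rep z, classPoint_eq_iff]
      exact ⟨α, by rw [← hz, zero_smul, add_zero]⟩
    have hx₁S : x₁ ∉ L₂ ⊔ F ∙ w := by
      intro hmem
      obtain ⟨a, ha, y, hy, he⟩ := Submodule.mem_sup.1 hmem
      obtain ⟨b, rfl⟩ := Submodule.mem_span_singleton.1 hy
      have h1 := hpr x₁ hx₁P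
      rw [← he, polar_add_left, h.polar_eq_zero' hr ha, zero_add, polar_smul_left] at h1
      rw [(smul_eq_zero.1 h1).resolve_right hwr, zero_smul, add_zero] at he
      exact hx₁' (he ▸ ha)
    obtain ⟨g, hgS, hgx⟩ := exists_perp_polar_ne_zero hQ hx₁S
    obtain ⟨v, hvK, hQv, -, hvn⟩ := exists_same_polar_on h2 hQ hK hKfin hu₀ g (Q x₁)
    have hvε : quadraticChar F (Q v) = (ε : ℤ) := by rw [hQv, hx₁ε]
    have hvL : ∀ s ∈ L₂, polar Q v s = 0 := fun s hs => by
      rw [hvK s (hPK (le_sup_right (a := L₁) hs))]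
      exact hgS s (le_sup_left (a := L₂) hs)
    have hvw : polar Q v w = 0 := by
      rw [hvK w hwK]
      exact hgS w (le_sup_right (a := L₂) (Submodule.mem_span_singleton_self w))
    have hvx : polar Q v x₁ ≠ 0 := by rwa [hvK x₁ (hPK hx₁P)]
    have hvC := hC hvε fun hc => hvn (hPK hc)
    refine ⟨classPoint Q v hvε, ?_, ?_, fun hadj => ?_⟩
    · refine h.adj_of_nbrIn_right h2 hx₁ hx₁' hx₁ε hx₂ hx₂' hx₂ε hvC (fun u hu => ?_) ?_ ?_ ?_
      · rw [polar_rep_classPoint_eq_zero_iff, hvL u hu.2]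
      · rwa [Ne, polar_rep_classPoint_eq_zero_iff]
      · rw [polar_rep_classPoint_eq_zero_iff, hvL x₂ hx₂]
      · rw [mem_pointDiff_iff, rep_classPoint_mem_iff, rep_classPoint_mem_iff]
        exact ⟨hx₁, hx₁'⟩
    · rw [switchedOrthGraph_adj_of_notMem hvC (hC hwε hwP), adj_classPoint_left h2, hrep, hvw]
    · have hzC : z ∉ pointDiff Q ε L₁ L₂ ∪ pointDiff Q ε L₂ L₁ := by
        intro hc
        have h1 := h.polar_eq_zero_of_mem_union hc hr
        rw [← hz, polar_add_left, polar_smul_left, polar_smul_left, h.polar_eq_zero hr hx₁,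
          smul_zero, zero_add] at h1
        exact hβ ((smul_eq_zero.1 h1).resolve_right hwr)
      rw [switchedOrthGraph_adj_of_notMem hvC hzC, adj_classPoint_left h2, ← hz, polar_add_right,
        polar_smul_right, polar_smul_right, hvw, smul_zero, add_zero] at hadj
      exact hα ((smul_eq_zero.1 hadj).resolve_right hvx)
  · -- otherwise a common neighbour not orthogonal to `r` does it
    have hrS : r ∉ Submodule.span F {x₁, w} := by
      intro hmem
      obtain ⟨a, b, he⟩ := Submodule.mem_span_pair.1 hmem
      have h1 := hpr r hrP
      rw [← he, polar_add_left, polar_smul_left, polar_smul_left, he, hpr x₁ hx₁P, smul_zero,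
        zero_add] at h1
      rw [(smul_eq_zero.1 h1).resolve_right hwr, zero_smul, add_zero] at he
      have ha : a ≠ 0 := by
        rintro rfl
        exact hr0 (by rw [← he, zero_smul])
      exact hx₁' ((Submodule.smul_mem_iff L₂ ha).1 (he ▸ hr.2))
    obtain ⟨v, hvS, hvr, hQv, hvz⟩ : ∃ v, (∀ s ∈ Submodule.span F {x₁, w}, polar Q v s = 0) ∧
        polar Q v r ≠ 0 ∧ Q v = Q x₁ ∧ polar Q v z.1.rep ≠ 0 := by
      have hSK : Submodule.span F {x₁, w} ≤ K := by
        rw [Submodule.span_le]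
        rintro s (rfl | rfl)
        · exact hPK hx₁P
        · exact hwK
      by_cases huK : z.1.rep ∈ K
      · obtain ⟨g, hgS, hgr, hgz⟩ := exists_perp_polar_ne_zero₂ hQ hrS hu
        obtain ⟨v, hvK, hQv, -, -⟩ := exists_same_polar_on h2 hQ hK hKfin hu₀ g (Q x₁)
        exact ⟨v, fun s hs => by rw [hvK s (hSK hs), hgS s hs], by rwa [hvK r (hPK hrP)], hQv,
          by rwa [hvK _ huK]⟩
      · obtain ⟨g, hgS, hgr⟩ := exists_perp_polar_ne_zero hQ hrS
        obtain ⟨v, hvK, hQv, hvz, -⟩ := exists_same_polar_on h2 hQ hK hKfin huK g (Q x₁)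
        exact ⟨v, fun s hs => by rw [hvK s (hSK hs), hgS s hs], by rwa [hvK r (hPK hrP)], hQv,
          hvz⟩
    have hvε : quadraticChar F (Q v) = (ε : ℤ) := by rw [hQv, hx₁ε]
    refine ⟨classPoint Q v hvε, ?_, ?_, ?_⟩
    · rw [hnotadj hvε _ hvr, hrep]
      exact hvS x₁ (Submodule.subset_span (by simp))
    · rw [hnotadj hvε _ hvr, hrep]
      exact hvS w (Submodule.subset_span (by simp))
    · rwa [hnotadj hvε _ hvr]

omit [Fintype F] [DecidableEq F] [Finite V] h2 in
lemma QuotientHasType.mem_of_polar_eq_zero {P p : Submodule F V} {s : ℤˣ}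
    (hT : QuotientHasType Q P p s) {v : V} (hv : v ∈ P) (h : ∀ w ∈ P, polar Q v w = 0) :
    v ∈ p := by
  obtain ⟨Q', hQ', hnd, -⟩ := hT
  have hpol : ∀ a b : P, polar Q' (Submodule.Quotient.mk a) (Submodule.Quotient.mk b) =
      polar Q (a : V) b := fun a b => by
    rw [polar, ← Submodule.Quotient.mk_add, hQ', hQ', hQ']
    rfl
  have h0 := formNondegenerate_iff.1 hnd (Submodule.Quotient.mk ⟨v, hv⟩) fun w => by
    obtain ⟨w, rfl⟩ := Submodule.Quotient.mk_surjective _ w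
    rw [hpol]
    exact h w w.2
  exact (Submodule.Quotient.mk_eq_zero (p.submoduleOf P)).1 h0

theorem IsSwitchingPair.isEmpty_iso (hQ : FormNondegenerate Q) (hn : 7 ≤ finrank F V)
    (h : IsSwitchingPair Q ε 3 L₁ L₂) {s : ℤˣ} (hT : QuotientHasType Q (L₁ ⊔ L₂) (L₁ ⊓ L₂) s) :
    IsEmpty (switchedOrthGraph Q ε L₁ L₂ ≃g orthGraph Q ε) := by
  refine ⟨fun φ => ?_⟩
  obtain ⟨x, y, hne, hxy, hthird⟩ :=
    h.exists_pair_without_third h2 hQ hn fun v hv hw => hT.mem_of_polar_eq_zero hv hw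
  obtain ⟨z, hzx, hzy, hz⟩ := exists_third_vertex h2 (φ.injective.ne hne)
    (fun hadj => hxy (φ.map_adj_iff.1 hadj))
  obtain ⟨z, rfl⟩ := φ.surjective z
  obtain ⟨v, hvx, hvy, hvz⟩ := hthird z (fun h => hzx (by rw [h])) (fun h => hzy (by rw [h]))
  exact hvz (φ.map_adj_iff.1 (hz _ (φ.map_adj_iff.2 hvx) (φ.map_adj_iff.2 hvy)))

end NonIsomorphism

/-! ### Existence of switching pairs -/

section Existence

variable {F : Type*} [Field F] {V : Type*} [AddCommGroup V] [Module F V] {Q : QuadraticForm F V}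

lemma finrank_span_pair_eq_two {x y : V} (hy : y ≠ 0) (h : ∀ a : F, a • y ≠ x) :
    finrank F (Submodule.span F {x, y}) = 2 := by
  have hli : LinearIndependent F ![x, y] :=
    LinearIndependent.pair_symm_iff.1 ((LinearIndependent.pair_iff' hy).2 h)
  rw [← Matrix.range_cons_cons_empty x y ![], finrank_span_eq_card hli, Fintype.card_fin]

/-- If `Q` vanishes on `p` and `p` is orthogonal to `P`, then `Q` induces a form on `P / p`. -/
lemma exists_quotient_form {P p : Submodule F V} (h0 : ∀ u ∈ p, Q u = 0)
    (hP : ∀ v ∈ P, ∀ u ∈ p, polar Q v u = 0) :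
    ∃ Q' : QuadraticForm F (P ⧸ p.submoduleOf P),
      ∀ v : P, Q' (Submodule.Quotient.mk v) = Q (v : V) := by
  obtain ⟨σ, hσ⟩ := (p.submoduleOf P).mkQ.exists_rightInverse_of_surjective
    (Submodule.range_mkQ _)
  refine ⟨(Q.restrict P).comp σ, fun v => ?_⟩
  have hmem : σ (Submodule.Quotient.mk v) - v ∈ p.submoduleOf P := by
    rw [← Submodule.Quotient.mk_eq_zero, Submodule.Quotient.mk_sub, sub_eq_zero]
    exact LinearMap.congr_fun hσ (Submodule.Quotient.mk v)
  have hmem' : (σ (Submodule.Quotient.mk v) : V) - v ∈ p := hmem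
  have h1 := QuadraticMap.map_add Q (v : V) ((σ (Submodule.Quotient.mk v) : V) - v)
  rw [add_sub_cancel, h0 _ hmem', hP v v.2 _ hmem', add_zero, add_zero] at h1
  exact h1

variable [Fintype F] [DecidableEq F] [Finite V] (h2 : (2 : F) ≠ 0) {ε δ : ℤˣ}
include h2

/-- An orthogonal basis of a plane consisting of two vectors of the same class determines its
type. -/
lemma isEvenType_of_orthogonal_pair (hQ : FormNondegenerate Q) (hn : finrank F V = 2)
    (hδ : quadraticChar F (-1) = (δ : ℤ)) {x y : V} (hx : quadraticChar F (Q x) = (ε : ℤ))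
    (hy : quadraticChar F (Q y) = (ε : ℤ)) (hxy : polar Q x y = 0) : IsEvenType Q 1 δ := by
  have hy' : y ∈ ⊤ ⊓ perp Q (F ∙ x) := ⟨trivial, mem_perp_span_singleton.2 hxy⟩
  have h1 := finrank_inf_perp_of_map_ne_zero h2 (Submodule.mem_top (x := x))
    (map_ne_zero_of_class hx)
  have h3 := finrank_inf_perp_of_map_ne_zero h2 hy' (map_ne_zero_of_class hy)
  rw [finrank_top, hn] at h1
  have h0 : HasEvenCount Q (⊤ ⊓ perp Q (F ∙ x) ⊓ perp Q (F ∙ y)) 0 1 := by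
    rw [Submodule.finrank_eq_zero.1 (show finrank F
      ↥(⊤ ⊓ perp Q (F ∙ x) ⊓ perp Q (F ∙ y)) = 0 by omega)]
    exact hasEvenCount_bot Q
  have h4 := hasEvenCount_of_perp h2 hδ (Submodule.mem_top (x := x)) hx
    (hasOddCount_of_perp h2 hy' hy h0)
  rw [one_mul, Int.units_mul_self, one_mul] at h4
  exact h4.isEvenType hQ

/-- The pair is `⟨x₁, r⟩, ⟨x₂, r⟩` for orthogonal vectors `x₁, x₂` with the same value of class `ε`,
and a nonzero singular vector `r` orthogonal to both. -/
theorem exists_isSwitchingPair_three (hQ : FormNondegenerate Q) (hn : 7 ≤ finrank F V)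
    (hδ : quadraticChar F (-1) = (δ : ℤ)) :
    ∃ L₁ L₂ : Submodule F V, IsSwitchingPair Q ε 3 L₁ L₂ ∧
      QuotientHasType Q (L₁ ⊔ L₂) (L₁ ⊓ L₂) δ := by
  obtain ⟨c, hc⟩ := exists_quadraticChar_eq h2 ε
  have hc0 : c ≠ 0 := ne_zero_of_quadraticChar_eq hc
  have hW := nondegOn_top_iff.2 hQ
  obtain ⟨x₁, -, hx₁⟩ := exists_map_eq_of_two_le_finrank h2 hW (by rw [finrank_top]; omega) hc0
  have hx₁0 : Q x₁ ≠ 0 := by rwa [hx₁]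
  have hW₁ := hW.inf_perp h2 (Submodule.mem_top (x := x₁)) hx₁0
  have hf₁ := finrank_inf_perp_of_map_ne_zero h2 (Submodule.mem_top (x := x₁)) hx₁0
  rw [finrank_top] at hf₁
  obtain ⟨x₂, hx₂W, hx₂⟩ := exists_map_eq_of_two_le_finrank h2 hW₁ (by omega) hc0
  have hx₂0 : Q x₂ ≠ 0 := by rwa [hx₂]
  have hW₂ := hW₁.inf_perp h2 hx₂W hx₂0
  have hf₂ := finrank_inf_perp_of_map_ne_zero h2 hx₂W hx₂0
  obtain ⟨u, huW, hu0⟩ := Submodule.exists_mem_ne_zero_of_ne_bot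
    (show (⊤ ⊓ perp Q (F ∙ x₁) ⊓ perp Q (F ∙ x₂) : Submodule F V) ≠ ⊥ by
      intro h0
      rw [h0, finrank_bot] at hf₂
      omega)
  obtain ⟨r, hrW, hr, hru⟩ := exists_map_eq_polar_ne_zero h2 hW₂ (by omega) huW hu0 0
  have hr0 : r ≠ 0 := by rintro rfl; simp at hru
  have p12 : polar Q x₁ x₂ = 0 := mem_perp_span_singleton.1 hx₂W.2
  have p1r : polar Q x₁ r = 0 := mem_perp_span_singleton.1 hrW.1.2
  have p2r : polar Q x₂ r = 0 := mem_perp_span_singleton.1 hrW.2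
  have prr : polar Q r r = 0 := by rw [polar_self_eq, hr, mul_zero]
  have pr1 : polar Q r x₁ = 0 := by rw [polar_comm, p1r]
  have pr2 : polar Q r x₂ = 0 := by rw [polar_comm, p2r]
  have p21 : polar Q x₂ x₁ = 0 := by rw [polar_comm, p12]
  have p11 : polar Q x₁ x₁ ≠ 0 := by rw [polar_self_eq]; exact mul_ne_zero h2 hx₁0
  have p22 : polar Q x₂ x₂ ≠ 0 := by rw [polar_self_eq]; exact mul_ne_zero h2 hx₂0
  -- coefficients in `⟨x, y, r⟩` of a vector orthogonal to `x`
  have hcoef : ∀ {x : V}, polar Q x x ≠ 0 → polar Q r x = 0 → ∀ {a b : F} {v : V},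
      v = a • x + b • r → polar Q v x = 0 → a = 0 := by
    rintro x hx hrx a b v rfl hv
    rw [polar_add_left, polar_smul_left, polar_smul_left, hrx, smul_zero, add_zero] at hv
    exact (smul_eq_zero.1 hv).resolve_right hx
  have hfin : ∀ {x : V}, polar Q x x ≠ 0 → polar Q r x = 0 →
      finrank F (Submodule.span F {x, r}) = 2 := by
    intro x hx hrx
    refine finrank_span_pair_eq_two hr0 fun a ha => hx ?_
    rw [← ha, polar_smul_left, polar_smul_right, prr, smul_zero, smul_zero]
  have hinf : Submodule.span F {x₁, r} ⊓ Submodule.span F {x₂, r} = F ∙ r := by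
    ext v
    rw [Submodule.mem_inf, Submodule.mem_span_singleton]
    constructor
    · rintro ⟨hv₁, hv₂⟩
      obtain ⟨a, b, rfl⟩ := Submodule.mem_span_pair.1 hv₁
      obtain ⟨a', b', he⟩ := Submodule.mem_span_pair.1 hv₂
      have ha := hcoef p11 pr1 (rfl : a • x₁ + b • r = _) (by
        rw [← he, polar_add_left, polar_smul_left, polar_smul_left, p21, pr1, smul_zero, smul_zero,
          add_zero])
      exact ⟨b, by rw [ha, zero_smul, zero_add]⟩
    · rintro ⟨a, rfl⟩
      exact ⟨Submodule.mem_span_pair.2 ⟨0, a, by simp⟩,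
        Submodule.mem_span_pair.2 ⟨0, a, by simp⟩⟩
  have hrad : ∀ {x : V}, polar Q x x ≠ 0 → polar Q x r = 0 →
      Submodule.span F {x, r} ⊓ perp Q (Submodule.span F {x, r}) = F ∙ r := by
    intro x hx hxr
    have hrx : polar Q r x = 0 := by rw [polar_comm, hxr]
    ext v
    rw [Submodule.mem_inf, Submodule.mem_span_singleton, mem_perp_iff]
    constructor
    · rintro ⟨hv₁, hv₂⟩
      obtain ⟨a, b, rfl⟩ := Submodule.mem_span_pair.1 hv₁
      have ha := hcoef hx hrx (rfl : a • x + b • r = _) (by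
        rw [polar_comm]; exact hv₂ x (Submodule.subset_span (by simp)))
      exact ⟨b, by rw [ha, zero_smul, zero_add]⟩
    · rintro ⟨a, rfl⟩
      refine ⟨Submodule.mem_span_pair.2 ⟨0, a, by simp⟩, fun u hu => ?_⟩
      obtain ⟨b, b', rfl⟩ := Submodule.mem_span_pair.1 hu
      simp only [polar_add_left, polar_smul_left, polar_smul_right, hxr, prr, smul_zero, add_zero]
  have htype : ∀ {x : V}, Q x = c → polar Q x r = 0 → ∀ {L : Submodule F V}, r ∈ L →
      ∀ y : ℙ F V, y.submodule ≤ Submodule.span F {x, r} → ¬ y.submodule ≤ L →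
        quadraticChar F (Q y.rep) = (ε : ℤ) := by
    intro x hx hxr L hrL y hy hy'
    rw [submodule_le_iff] at hy hy'
    obtain ⟨a, b, he⟩ := Submodule.mem_span_pair.1 hy
    have ha : a ≠ 0 := by
      rintro rfl
      rw [zero_smul, zero_add] at he
      exact hy' (he ▸ L.smul_mem _ hrL)
    rw [← he, polar_smul_self_add, polar_smul_right, hxr, QuadraticMap.map_smul, hr, smul_zero,
      smul_zero, mul_zero, add_zero, add_zero, map_mul, quadraticChar_sq_one' ha, one_mul, hx, hc]
  have hpair : IsSwitchingPair Q ε 3 (Submodule.span F {x₁, r}) (Submodule.span F {x₂, r}) :=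
    { finrank_left := by rw [hfin p11 pr1]
      finrank_right := by rw [hfin p22 pr2]
      finrank_inf := by rw [hinf, finrank_span_singleton hr0]
      radical_left := by rw [hinf, hrad p11 p1r]
      radical_right := by rw [hinf, hrad p22 p2r]
      type_left := htype hx₁ p1r (Submodule.subset_span (by simp))
      type_right := htype hx₂ p2r (Submodule.subset_span (by simp)) }
  refine ⟨_, _, hpair, ?_⟩
  have hx₁P : x₁ ∈ Submodule.span F {x₁, r} ⊔ Submodule.span F {x₂, r} :=
    le_sup_left (a := Submodule.span F {x₁, r}) (Submodule.subset_span (by simp))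
  have hx₂P : x₂ ∈ Submodule.span F {x₁, r} ⊔ Submodule.span F {x₂, r} :=
    le_sup_right (a := Submodule.span F {x₁, r}) (Submodule.subset_span (by simp))
  have hfinP := Submodule.finrank_sup_add_finrank_inf_eq (Submodule.span F {x₁, r})
    (Submodule.span F {x₂, r})
  rw [hfin p11 pr1, hfin p22 pr2, hinf, finrank_span_singleton hr0] at hfinP
  rw [hinf]
  have hdec : ∀ v ∈ Submodule.span F {x₁, r} ⊔ Submodule.span F {x₂, r},
      ∃ a b t : F, v = a • x₁ + b • x₂ + t • r := by
    intro v hv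
    obtain ⟨y, hy, z, hz, rfl⟩ := Submodule.mem_sup.1 hv
    obtain ⟨a, t, rfl⟩ := Submodule.mem_span_pair.1 hy
    obtain ⟨b, t', rfl⟩ := Submodule.mem_span_pair.1 hz
    exact ⟨a, b, t + t', by module⟩
  set P := Submodule.span F {x₁, r} ⊔ Submodule.span F {x₂, r} with hPdef
  have hpP : F ∙ r ≤ P := by
    rw [Submodule.span_singleton_le_iff_mem]
    exact le_sup_left (a := Submodule.span F {x₁, r}) (Submodule.subset_span (by simp))
  obtain ⟨Q', hQ'⟩ := exists_quotient_form (Q := Q) (P := P) (p := F ∙ r)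
    (fun u hu => by
      obtain ⟨a, rfl⟩ := Submodule.mem_span_singleton.1 hu
      rw [QuadraticMap.map_smul, hr, smul_zero])
    (fun v hv u hu => by
      obtain ⟨s, rfl⟩ := Submodule.mem_span_singleton.1 hu
      obtain ⟨a, b, t, rfl⟩ := hdec v hv
      simp only [polar_add_left, polar_smul_left, polar_smul_right, p1r, p2r, prr, smul_zero,
        add_zero])
  have hpol : ∀ a b : P, polar Q' (Submodule.Quotient.mk a) (Submodule.Quotient.mk b) =
      polar Q (a : V) b := fun a b => by
    rw [polar, ← Submodule.Quotient.mk_add, hQ', hQ', hQ']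
    rfl
  have hfinite : Finite (P ⧸ (F ∙ r).submoduleOf P) := Quotient.finite _
  refine ⟨Q', hQ', isEvenType_of_orthogonal_pair (ε := ε) h2 ?_ ?_ hδ
    (x := Submodule.Quotient.mk ⟨x₁, hx₁P⟩) (y := Submodule.Quotient.mk ⟨x₂, hx₂P⟩) ?_ ?_ ?_⟩
  · rw [formNondegenerate_iff]
    intro v hv
    obtain ⟨⟨v, hvP⟩, rfl⟩ := Submodule.Quotient.mk_surjective _ v
    have h1 := hv (Submodule.Quotient.mk ⟨x₁, hx₁P⟩)
    have h3 := hv (Submodule.Quotient.mk ⟨x₂, hx₂P⟩)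
    rw [hpol] at h1 h3
    obtain ⟨a, b, t, rfl⟩ := hdec v hvP
    simp only [polar_add_left, polar_smul_left, p21, pr1, p12, pr2, smul_zero, add_zero,
      zero_add, smul_eq_zero, p11, p22, or_false] at h1 h3
    rw [Submodule.Quotient.mk_eq_zero]
    refine Submodule.mem_span_singleton.2 ⟨t, ?_⟩
    simp [h1, h3]
  · have h1 := Submodule.finrank_quotient_add_finrank ((F ∙ r).submoduleOf P)
    rw [(Submodule.submoduleOfEquivOfLe hpP).finrank_eq, finrank_span_singleton hr0] at h1
    omega
  · rw [hQ']; simpa [hx₁] using hc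
  · rw [hQ']; simpa [hx₂] using hc
  · rw [hpol]; exact p12

end Existence

/-! ### The families over `𝔽₃` and `𝔽₅` -/

section Main

variable {F V : Type*} [Field F] [Fintype F] [DecidableEq F]
  [AddCommGroup V] [Module F V] [Finite V] {Q : QuadraticForm F V} {ε : ℤˣ}

lemma quadraticChar_neg_one_eq_deltaSign (h2 : (2 : F) ≠ 0) (hodd : Odd (Fintype.card F)) :
    quadraticChar F (-1) = (deltaSign (Fintype.card F) : ℤ) := by
  rw [quadraticChar_neg_one (ringChar_ne_two_of_two_ne_zero h2), ZMod.χ₄_nat_eq_if_mod_four,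
    if_neg (by rw [Nat.odd_iff.1 hodd]; decide), deltaSign]
  split_ifs <;> simp

lemma IsSwitchingPair.stronglyRegular (h2 : (2 : F) ≠ 0) {m v k l mu : ℕ} {L₁ L₂ : Submodule F V}
    [Finite (ClassPoint Q ε)] (hΓ : StronglyRegular (orthGraph Q ε) v k l mu)
    (h : IsSwitchingPair Q ε m L₁ L₂) :
    StronglyRegular (switchedOrthGraph Q ε L₁ L₂) v k l mu :=
  hΓ.switchedGraph (h.isSwitchingSet h2) (h.pointDiff_nonempty h2)

/-- The sign `s` of the value counts on `V` gives the type of the hyperplanes `x^⊥`. -/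
lemma HasOddCount.isEvenType_perp (h2 : (2 : F) ≠ 0) (hQ : FormNondegenerate Q) {d : ℕ} {s : ℤˣ}
    (hs : HasOddCount Q ⊤ d s) (x : ClassPoint Q ε) :
    IsEvenType (Q.restrict (perp Q x.1.submodule)) d (s * ε) := by
  have hW := nondegOn_top_iff.2 hQ
  have h1 := hs.inf_perp h2 hW trivial x.2
  have h3 := hW.inf_perp h2 (Submodule.mem_top (x := x.1.rep)) (map_ne_zero_of_class x.2)
  rw [top_inf_eq, ← Projectivization.submodule_eq] at h1 h3
  refine HasEvenCount.isEvenType (formNondegenerate_restrict_iff.2 h3) ⟨?_, fun c => ?_⟩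
  · rw [finrank_top, h1.finrank_eq]
  · rw [levelCount_restrict, h1.count]

end Main

theorem theorem10 {F V : Type*} [Field F] [Fintype F] [DecidableEq F]
    [AddCommGroup V] [Module F V] [Finite V]
    (q n d : ℕ) (hq : Fintype.card F = q) (hodd : Odd q) (hd : 2 ≤ d)
    (hn : n = 2 * d + 1 ∨ n = 2 * d) (hV : finrank F V = n)
    (Q : QuadraticForm F V) (hQ : FormNondegenerate Q) (ε : ℤˣ) :
    -- the switching sets
    (∀ (m : ℕ) (L₁ L₂ : Submodule F V), 3 ≤ m → m ≤ d → IsSwitchingPair Q ε m L₁ L₂ →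
      IsSwitchingSet (orthGraph Q ε) (pointDiff Q ε L₁ L₂) (pointDiff Q ε L₂ L₁)) ∧
    -- non-isomorphy for `m = 3` and `P / p` of type `O^δ(2, q)`
    (7 ≤ n → ∀ L₁ L₂ : Submodule F V, IsSwitchingPair Q ε 3 L₁ L₂ →
      QuotientHasType Q (L₁ ⊔ L₂) (L₁ ⊓ L₂) (deltaSign q) →
      IsEmpty (switchedOrthGraph Q ε L₁ L₂ ≃g orthGraph Q ε)) ∧
    -- such a pair of subspaces exists
    (7 ≤ n → ∃ L₁ L₂ : Submodule F V, IsSwitchingPair Q ε 3 L₁ L₂ ∧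
      QuotientHasType Q (L₁ ⊔ L₂) (L₁ ⊓ L₂) (deltaSign q)) ∧
    -- strong regularity, `O(2d+1, 3)`
    (q = 3 → n = 2 * d + 1 →
      ∃ e : ℤˣ, (∀ x : ClassPoint Q ε, IsEvenType (Q.restrict (perp Q x.1.submodule)) d e) ∧
      ∃ v k l mu : ℕ,
        2 * (v : ℤ) = 3 ^ d * (3 ^ d + e) ∧
        2 * (k : ℤ) = 3 ^ (d - 1) * (3 ^ d - e) ∧
        2 * (l : ℤ) = 3 ^ (d - 1) * (3 ^ (d - 1) - e) ∧
        2 * (mu : ℤ) = 3 ^ (d - 1) * (3 ^ (d - 1) - e) ∧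
        StronglyRegular (orthGraph Q ε) v k l mu ∧
        ∀ (m : ℕ) (L₁ L₂ : Submodule F V), 3 ≤ m → m ≤ d → IsSwitchingPair Q ε m L₁ L₂ →
          StronglyRegular (switchedOrthGraph Q ε L₁ L₂) v k l mu) ∧
    -- strong regularity, `O^ζ(2d, 3)`
    (q = 3 → n = 2 * d →
      ∃ ζ : ℤˣ, IsEvenType Q d ζ ∧
      ∃ v k l mu : ℕ,
        2 * (v : ℤ) = 3 ^ (d - 1) * (3 ^ d - ζ) ∧
        2 * (k : ℤ) = 3 ^ (d - 1) * (3 ^ (d - 1) - ζ) ∧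
        2 * (l : ℤ) = 3 ^ (d - 2) * (3 ^ (d - 1) + ζ) ∧
        2 * (mu : ℤ) = 3 ^ (d - 1) * (3 ^ (d - 2) - ζ) ∧
        StronglyRegular (orthGraph Q ε) v k l mu ∧
        ∀ (m : ℕ) (L₁ L₂ : Submodule F V), 3 ≤ m → m ≤ d → IsSwitchingPair Q ε m L₁ L₂ →
          StronglyRegular (switchedOrthGraph Q ε L₁ L₂) v k l mu) ∧
    -- strong regularity, `O(2d+1, 5)`
    (q = 5 → n = 2 * d + 1 →
      ∃ e : ℤˣ, (∀ x : ClassPoint Q ε, IsEvenType (Q.restrict (perp Q x.1.submodule)) d e) ∧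
      ∃ v k l mu : ℕ,
        2 * (v : ℤ) = 5 ^ d * (5 ^ d + e) ∧
        2 * (k : ℤ) = 5 ^ (d - 1) * (5 ^ d - e) ∧
        2 * (l : ℤ) = 5 ^ (d - 1) * (5 ^ (d - 1) + e) ∧
        2 * (mu : ℤ) = 5 ^ (d - 1) * (5 ^ (d - 1) - e) ∧
        StronglyRegular (orthGraph Q ε) v k l mu ∧
        ∀ (m : ℕ) (L₁ L₂ : Submodule F V), 3 ≤ m → m ≤ d → IsSwitchingPair Q ε m L₁ L₂ →
          StronglyRegular (switchedOrthGraph Q ε L₁ L₂) v k l mu) := by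
  subst hq
  have h2 : (2 : F) ≠ 0 := Ring.two_ne_zero fun h => by
    have := FiniteField.even_card_iff_char_two.1 h
    have := Nat.odd_iff.1 hodd
    omega
  have hW : NondegOn Q ⊤ := nondegOn_top_iff.2 hQ
  have hδ := quadraticChar_neg_one_eq_deltaSign h2 hodd
  obtain ⟨heven, hoddc⟩ := exists_count_of_nondegOn h2 n hW (by rw [finrank_top, hV])
  refine ⟨fun m L₁ L₂ _ _ h => h.isSwitchingSet h2,
    fun hn7 L₁ L₂ h hT => h.isEmpty_iso h2 hQ (by omega) hT,
    fun hn7 => exists_isSwitchingPair_three h2 hQ (by omega) hδ,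
    fun h3 hn' => ?_, fun h3 hn' => ?_, fun h5 hn' => ?_⟩
  · obtain ⟨s, hs⟩ := hoddc d hn'
    obtain ⟨d, rfl⟩ : ∃ j, d = j + 1 := ⟨d - 1, by omega⟩
    have hδ' : deltaSign (Fintype.card F) = -1 := by rw [h3]; rfl
    obtain ⟨v, hv⟩ := exists_pow_mul_pow_add_sign hodd (d + 1) (d + 1) (s * ε)
    obtain ⟨k, hk⟩ := exists_pow_mul_pow_add_sign hodd d (d + 1) (-(s * ε))
    obtain ⟨l, hl⟩ := exists_pow_mul_pow_add_sign hodd d d (-(s * ε))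
    have hΓ : StronglyRegular (orthGraph Q ε) v k l l := by
      refine stronglyRegular_of_hasOddCount h2 hQ hs hδ
        (fun x y hx hy hxy => Or.inl (degenerate_plane_of_card_three h3 hx hy hxy)) hv ?_ ?_ ?_
      · rw [hk]; push_cast; ring
      · rw [hl, hδ']; push_cast; ring
      · rw [hl]; push_cast; ring
    rw [h3] at hv hk hl
    refine ⟨s * ε, hs.isEvenType_perp h2 hQ, v, k, l, l, ?_, ?_, ?_, ?_, hΓ,
      fun m L₁ L₂ _ _ h => h.stronglyRegular h2 hΓ⟩
    · rw [hv]; push_cast; ring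
    · rw [hk, Nat.add_sub_cancel]; push_cast; ring
    · rw [hl, Nat.add_sub_cancel]; push_cast; ring
    · rw [hl, Nat.add_sub_cancel]; push_cast; ring
  · obtain ⟨s, hs⟩ := heven d hn'
    have htype := hs.isEvenType hQ
    obtain ⟨d, rfl⟩ : ∃ j, d = j + 2 := ⟨d - 2, by omega⟩
    have hδ' : deltaSign (Fintype.card F) = -1 := by rw [h3]; rfl
    obtain ⟨v, hv⟩ := exists_pow_mul_pow_add_sign hodd (d + 1) (d + 2) (-s)
    obtain ⟨k, hk⟩ := exists_pow_mul_pow_add_sign hodd (d + 1) (d + 1) (-s)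
    obtain ⟨l, hl⟩ := exists_pow_mul_pow_add_sign hodd d (d + 1) s
    obtain ⟨mu, hmu⟩ := exists_pow_mul_pow_add_sign hodd (d + 1) d (-s)
    have hΓ : StronglyRegular (orthGraph Q ε) v k l mu := by
      refine stronglyRegular_of_hasEvenCount h2 hQ hs hδ
        (fun x y hx hy hxy => degenerate_plane_of_card_three h3 hx hy hxy) ?_ ?_ ?_ ?_
      · rw [hv]; push_cast; ring
      · rw [hk, hδ']; push_cast; ring
      · rw [hl, hδ']; push_cast; ring
      · rw [hmu, hδ']; push_cast; ring
    rw [h3] at hv hk hl hmu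
    have e1 : d + 2 - 1 = d + 1 := rfl
    refine ⟨s, htype, v, k, l, mu, ?_, ?_, ?_, ?_, hΓ,
      fun m L₁ L₂ _ _ h => h.stronglyRegular h2 hΓ⟩
    · rw [hv, e1]; push_cast; ring
    · rw [hk, e1]; push_cast; ring
    · rw [hl, e1, Nat.add_sub_cancel]; push_cast; ring
    · rw [hmu, e1, Nat.add_sub_cancel]; push_cast; ring
  · obtain ⟨s, hs⟩ := hoddc d hn'
    obtain ⟨d, rfl⟩ : ∃ j, d = j + 1 := ⟨d - 1, by omega⟩
    have hδ' : deltaSign (Fintype.card F) = 1 := by rw [h5]; rfl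
    obtain ⟨v, hv⟩ := exists_pow_mul_pow_add_sign hodd (d + 1) (d + 1) (s * ε)
    obtain ⟨k, hk⟩ := exists_pow_mul_pow_add_sign hodd d (d + 1) (-(s * ε))
    obtain ⟨l, hl⟩ := exists_pow_mul_pow_add_sign hodd d d (s * ε)
    obtain ⟨mu, hmu⟩ := exists_pow_mul_pow_add_sign hodd d d (-(s * ε))
    have hΓ : StronglyRegular (orthGraph Q ε) v k l mu := by
      refine stronglyRegular_of_hasOddCount h2 hQ hs hδ (fun x y hx hy hxy => ?_) hv ?_ ?_ ?_
      · rw [hδ']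
        simpa using plane_of_card_five h2 h5 hx hy hxy
      · rw [hk]; push_cast; ring
      · rw [hl, hδ']; push_cast; ring
      · rw [hmu]; push_cast; ring
    rw [h5] at hv hk hl hmu
    refine ⟨s * ε, hs.isEvenType_perp h2 hQ, v, k, l, mu, ?_, ?_, ?_, ?_, hΓ,
      fun m L₁ L₂ _ _ h => h.stronglyRegular h2 hΓ⟩
    · rw [hv]; push_cast; ring
    · rw [hk, Nat.add_sub_cancel]; push_cast; ring
    · rw [hl, Nat.add_sub_cancel]; push_cast; ring
    · rw [hmu, Nat.add_sub_cancel]; push_cast; ring
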